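/- Let $\mathcal{F}=\{1,\dots,m\}$ be a set of features with finite domains $D_1,\dots,D_m$, let $\mathbb{F}=D_1\times\cdots\times D_m$, and let $\kappa:\mathbb{F}\to\{0,1\}$ be a classifier represented by a (multi-valued) deterministic decomposable Boolean circuit (DDBC), that is, by a directed acyclic graph of gates with exactly one gate, the output gate, without outgoing edges, in which: - a gate without incoming edges is a constant gate $0$ or $1$, or a variable gate that tests an equality $x_j=a$ with $j\in\mathcal{F}$ and $a\in D_j$; every other gate is a NOT gate (with one input), an AND gate or an OR gate; - any two inputs of an OR gate are never both $1$ at the same point of $\mathbb{F}$ (determinism); - for any two inputs of an AND gate, the sets of features that label the variable gates of the two corresponding subcircuits are disjoint (decomposability). For $\mathbf{v}\in\mathbb{F}$ let $\sigma(\mathbf{x})=1$ if $\kappa(\mathbf{x})=\kappa(\mathbf{v})$ and $\sigma(\mathbf{x})=0$ otherwise. For $\mathcal{S}\subseteq\mathcal{F}$ let $\Upsilon(\mathcal{S})=\{\mathbf{x}\in\mathbb{F} : x_j=v_j \text{ for all } j\in\mathcal{S}\}$, let $$\nu_s(\mathcal{S})=\frac{1}{|\Upsilon(\mathcal{S})|}\sum_{\mathbf{x}\in\Upsilon(\mathcal{S})}\sigma(\mathbf{x})$$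 be the similarity characteristic function, and for $i\in\mathcal{F}$ let $$\mathrm{Sv}_S(i)=\sum_{\mathcal{S}\subseteq\mathcal{F}\setminus\{i\}}\frac{|\mathcal{S}|!\,(m-|\mathcal{S}|-1)!}{m!}\,\bigl(\nu_s(\mathcal{S}\cup\{i\})-\nu_s(\mathcal{S})\bigr)$$ be the SHAP score of feature $i$ based on it. Then the scores $\mathrm{Sv}_S(i)$ are computable in polynomial time: there is a Turing machine that, given the domain sizes $|D_1|,\dots,|D_m|$ (in binary), a DDBC representing $\kappa$ with its gates listed in a topological order, the point $\mathbf{v}$ and the feature $i$, outputs integers $p$ and $q\neq 0$ (in binary) with $\mathrm{Sv}_S(i)=p/q$, in a number of steps that is bounded by a polynomial in the length of the input. -/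

import Mathlib

namespace SimShap

/-! ### Feature spaces, similarity, Shapley values -/

/-- The feature space `𝔽 = D₁ × ⋯ × Dₘ`; feature `j` has a finite domain with `D j` values. -/
abbrev Point {m : ℕ} (D : Fin m → ℕ) : Type := (j : Fin m) → Fin (D j)

/-- `Υ(S; v)`: the points of feature space that agree with `v` on the features in `S`. -/
def consistent {m : ℕ} {D : Fin m → ℕ} (v : Point D) (S : Finset (Fin m)) : Finset (Point D) :=
  Finset.univ.filter fun x => ∀ j ∈ S, x j = v j

/-- `E[τ(x) | x_S = v_S]` for the uniform distribution on feature space. -/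
noncomputable def condExpect {m : ℕ} {D : Fin m → ℕ} (τ : Point D → ℝ) (v : Point D)
    (S : Finset (Fin m)) : ℝ :=
  1 / ((consistent v S).card : ℝ) * ∑ x ∈ consistent v S, τ x

/-- The similarity predicate `σ(x) = [κ(x) = κ(v)]` of a classifier `κ`, as a `0/1` function. -/
def similarity {m : ℕ} {D : Fin m → ℕ} {K : Type} [DecidableEq K] (κ : Point D → K)
    (v x : Point D) : ℝ :=
  if κ x = κ v then 1 else 0

/-- The similarity characteristic function `S ↦ E[σ(x) | x_S = v_S]`. -/
noncomputable def simCharFun {m : ℕ} {D : Fin m → ℕ} {K : Type} [DecidableEq K]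
    (κ : Point D → K) (v : Point D) (S : Finset (Fin m)) : ℝ :=
  condExpect (similarity κ v) v S

/-- The Shapley value of `i` for the characteristic function `ν`:
`∑_{S ⊆ F ∖ {i}} |S|! (m - |S| - 1)! / m! * (ν (S ∪ {i}) - ν S)`. -/
noncomputable def shapley {m : ℕ} (ν : Finset (Fin m) → ℝ) (i : Fin m) : ℝ :=
  ∑ S ∈ (Finset.univ \ {i}).powerset,
    ((S.card.factorial * (m - S.card - 1).factorial : ℕ) : ℝ) / (m.factorial : ℝ) *
      (ν (S ∪ {i}) - ν S)

/-! ### Deterministic decomposable Boolean circuits over multi-valued features -/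

/-- A gate whose inputs are taken among the `k` gates that precede it in the list of gates.
A variable gate `var j a` tests whether feature `j` has the value `a`. -/
inductive Gate {m : ℕ} (D : Fin m → ℕ) (k : ℕ) : Type
  | const (b : Bool) : Gate D k
  | var (j : Fin m) (a : Fin (D j)) : Gate D k
  | not (g : Fin k) : Gate D k
  | and (gs : List (Fin k)) : Gate D k
  | or (gs : List (Fin k)) : Gate D k

/-- The inputs of a gate. -/
def Gate.inputs {m : ℕ} {D : Fin m → ℕ} {k : ℕ} : Gate D k → List (Fin k)
  | .const _ => []
  | .var _ _ => []
  | .not g => [g]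
  | .and gs => gs
  | .or gs => gs

/-- A Boolean circuit: a directed acyclic graph with `n + 1` gates of arbitrary fan-in, listed in a
topological order. -/
structure Circuit {m : ℕ} (D : Fin m → ℕ) : Type where
  n : ℕ
  gate : (k : Fin (n + 1)) → Gate D k
  /-- A gate without inputs is a variable or a constant gate. -/
  and_ne_nil : ∀ k, gate k ≠ .and []
  or_ne_nil : ∀ k, gate k ≠ .or []
  /-- Only the last gate, the output gate, is not an input of another gate. -/
  single_output : ∀ k, k ≠ Fin.last n → ∃ k', ∃ g ∈ (gate k').inputs, (g : ℕ) = k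

namespace Circuit

variable {m : ℕ} {D : Fin m → ℕ}

/-- The gate of `C` that an input `g` of the gate `k` refers to. -/
abbrev src (C : Circuit D) (k : Fin (C.n + 1)) (g : Fin k) : Fin (C.n + 1) :=
  ⟨g, g.2.trans k.2⟩

/-- The value of the gate `k` at the point `x`. -/
def eval (C : Circuit D) (x : Point D) (k : Fin (C.n + 1)) : Bool :=
  match C.gate k with
  | .const b => b
  | .var j a => decide (x j = a)
  | .not g => !(C.eval x (C.src k g))
  | .and gs => gs.all fun g => C.eval x (C.src k g)
  | .or gs => gs.any fun g => C.eval x (C.src k g)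
termination_by k.val
decreasing_by all_goals exact g.2

/-- `var(C_k)`: the features that label a variable gate of the subcircuit with output gate `k`. -/
def vars (C : Circuit D) (k : Fin (C.n + 1)) : Set (Fin m) :=
  match C.gate k with
  | .const _ => ∅
  | .var j _ => {j}
  | .not g => C.vars (C.src k g)
  | .and gs => {j | ∃ g ∈ gs, j ∈ C.vars (C.src k g)}
  | .or gs => {j | ∃ g ∈ gs, j ∈ C.vars (C.src k g)}
termination_by k.val
decreasing_by all_goals exact g.2

/-- No two inputs of an OR gate have the value `1` at the same point. -/
def Deterministic (C : Circuit D) : Prop :=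
  ∀ k gs, C.gate k = .or gs →
    gs.Pairwise fun g₁ g₂ =>
      ∀ x : Point D, ¬ (C.eval x (C.src k g₁) = true ∧ C.eval x (C.src k g₂) = true)

/-- The inputs of an AND gate are subcircuits on pairwise disjoint sets of features. -/
def Decomposable (C : Circuit D) : Prop :=
  ∀ k gs, C.gate k = .and gs →
    gs.Pairwise fun g₁ g₂ => Disjoint (C.vars (C.src k g₁)) (C.vars (C.src k g₂))

/-- The classifier represented by the circuit. -/
def classify (C : Circuit D) (x : Point D) : Bool :=
  C.eval x (Fin.last C.n)

end Circuit

/-- An input of the computational problem: an explanation problem for a classifier given by a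
deterministic and decomposable circuit, and a feature. -/
structure Instance : Type where
  m : ℕ
  D : Fin m → ℕ
  C : Circuit D
  deterministic : C.Deterministic
  decomposable : C.Decomposable
  v : Point D
  i : Fin m

/-- The SHAP score of the feature `I.i` for the similarity characteristic function. -/
noncomputable def Instance.score (I : Instance) : ℝ :=
  shapley (simCharFun I.C.classify I.v) I.i

/-! ### Encodings as strings over the alphabet `{0, 1, #}` -/

/-- Numbers are written in binary (least significant bit first), each followed by the separator
`none`. -/
def encodeNats (l : List ℕ) : List (Option Bool) :=
  l.flatMap fun a => a.bits.map some ++ [none]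

/-- The kind of the gate, its fan-in if that is not fixed, and its label or its inputs. -/
def Gate.toNats {m : ℕ} {D : Fin m → ℕ} {k : ℕ} : Gate D k → List ℕ
  | .const b => [0, b.toNat]
  | .var j a => [1, j, a]
  | .not g => [2, g]
  | .and gs => 3 :: gs.length :: gs.map Fin.val
  | .or gs => 4 :: gs.length :: gs.map Fin.val

/-- The number of features, the domain sizes, the point `v`, the feature `i`, and the circuit. -/
def Instance.encode (I : Instance) : List (Option Bool) :=
  encodeNats
    ([I.m] ++ List.ofFn I.D ++ List.ofFn (fun j => (I.v j : ℕ)) ++ [(I.i : ℕ)] ++ [I.C.n] ++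
      (List.ofFn fun k => (I.C.gate k).toNats).flatten)

/-- A fraction `p / q`, as the sign of `p` (`1` if `p` is negative), `|p|` and `q`. -/
def encodeFraction (r : ℤ × ℕ) : List (Option Bool) :=
  encodeNats [if r.1 < 0 then 1 else 0, r.1.natAbs, r.2]

end SimShap

namespace SimShap

/-! Since |Υ(S)| is the product of the D_j with j ∉ S, every ν(S) equals c(S)/P, where P = ∏ D_j and
c(S) is the natural number `scaledCount`. It therefore suffices to know, for each l, the sums of c(S
∪ {i}) and of c(S) over the sets S of size l that avoid i. Give a point x the weight ∏_j (a_j + b_j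
D_j [x_j = v_j]), with a_j = 1 and b_j = Z for j ≠ i. Expanding the product over subsets shows that
the points similar to v have total weight ∑_S Z^|S| c(S ∪ {i}) if (a_i, b_i) = (0, 1), and ∑_S Z^|S|
c(S) if (a_i, b_i) = (1, 0) (`weight_pos_part`, `weight_neg_part`). For Z = 2^m P + 1 there are no
carries, so the wanted sums are base-Z digits of these two numbers (`sum_pow_mul_digit`).

The weights form a product measure of total mass T, so the mass of the set where a gate is true can
be computed bottom up: NOT is a complement, OR is a sum by determinism, AND is a product divided by
T, because events on disjoint sets of features are independent (`weight_and_mul`). Masses always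
refer to the whole feature space, so the variables of subcircuits need not be tracked. The value
κ(v) is read off from weights concentrated at v. No mass exceeds T, which has polynomially many
bits.

For the machine model, structured programs on four stacks are compiled to `TM2` machines step by
step (`Exec.steps`). Data are binary trees in prefix code, and `PT` is the class of functions
computed on codes in polynomial time. It is closed under composition, pairing, case distinction and
folds whose intermediate states stay polynomially large (`PT.foldl`). Arithmetic and the algorithm
are written as such folds, and `PT.turing` passes to Turing machines. -/

open Function (update)

/-! ### A structured stack language and its compilation to `TM2` machines -/

/-- The stack alphabet. -/
abbrev Sym : Type := Option Bool

/-- The stacks: the work stack, an auxiliary stack, a counter and a copy buffer. -/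
inductive Stack : Type
  | main | aux | ctr | tmp
  deriving DecidableEq

instance : Fintype Stack :=
  ⟨{.main, .aux, .ctr, .tmp}, fun k => by cases k <;> simp⟩

/-- The contents of the stacks. -/
abbrev Store : Type := Stack → List Sym

/-- The store with given stacks. -/
def mkStore (m a c d : List Sym) : Store
  | .main => m
  | .aux => a
  | .ctr => c
  | .tmp => d

/-- Structured programs. `case` pops a symbol and continues with the program for that symbol;
`loop` does so repeatedly, as long as the popped symbol satisfies the test. -/
inductive Cmd : Type
  | skip
  | push (k : Stack) (a : Sym)
  | seq (c d : Cmd)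
  | case (k : Stack) (f : Option Sym → Cmd)
  | loop (k : Stack) (p : Option Sym → Bool) (f : Option Sym → Cmd)

infixr:60 " ;; " => Cmd.seq

/-- `Exec c S S' t`: started in the store `S`, the program `c` ends in `S'` after `t` steps. -/
inductive Exec : Cmd → Store → Store → ℕ → Prop
  | skip (S) : Exec .skip S S 1
  | push (k a S) : Exec (.push k a) S (update S k (a :: S k)) 1
  | seq {c d S S' S'' t u} : Exec c S S' t → Exec d S' S'' u → Exec (.seq c d) S S'' (t + u)
  | case {k f S S' t} : Exec (f (S k).head?) (update S k (S k).tail) S' t →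
      Exec (.case k f) S S' (t + 1)
  | loop_done {k p f S} : p (S k).head? = false →
      Exec (.loop k p f) S (update S k (S k).tail) 1
  | loop_step {k p f S S' S'' t u} : p (S k).head? = true →
      Exec (f (S k).head?) (update S k (S k).tail) S' t →
      Exec (.loop k p f) S' S'' u → Exec (.loop k p f) S S'' (t + u + 1)

/-- The labels of the machine that runs a program. -/
def Lab : Cmd → Type
  | .skip => Unit
  | .push _ _ => Unit
  | .seq c d => Lab c ⊕ Lab d
  | .case _ f => Option (Σ a, Lab (f a))
  | .loop _ _ f => Option (Σ a, Lab (f a))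

instance Lab.finite (c : Cmd) : Finite (Lab c) := by
  induction c with
  | skip => exact inferInstanceAs (Finite Unit)
  | push => exact inferInstanceAs (Finite Unit)
  | seq c d hc hd => exact inferInstanceAs (Finite (Lab c ⊕ Lab d))
  | case k f hf => exact inferInstanceAs (Finite (Option (Σ a, Lab (f a))))
  | loop k p f hf => exact inferInstanceAs (Finite (Option (Σ a, Lab (f a))))

/-- The label where a program starts. -/
def entry : (c : Cmd) → Lab c
  | .skip => ()
  | .push _ _ => ()
  | .seq c _ => .inl (entry c)
  | .case _ _ => none
  | .loop _ _ _ => none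

/-- Statements of the machines that run programs; the internal state is the last popped symbol. -/
abbrev MStmt (L : Type) : Type := Turing.TM2.Stmt (fun _ : Stack => Sym) L (Option Sym)

/-- The code of a program whose labels are embedded by `e` and that ends by jumping to `x`. -/
def compile {L : Type} : (c : Cmd) → (Lab c → L) → L → Lab c → MStmt L
  | .skip, _, x, _ => .goto fun _ => x
  | .push k a, _, x, _ => .push k (fun _ => a) (.goto fun _ => x)
  | .seq c d, e, _, .inl l => compile c (fun l => e (.inl l)) (e (.inr (entry d))) l
  | .seq _ d, e, x, .inr l => compile d (fun l => e (.inr l)) x l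
  | .case k f, e, _, none => .pop k (fun _ o => o) (.goto fun o => e (some ⟨o, entry (f o)⟩))
  | .case _ f, e, x, some ⟨a, l⟩ => compile (f a) (fun l => e (some ⟨a, l⟩)) x l
  | .loop k p f, e, x, none =>
      .pop k (fun _ o => o) (.goto fun o => if p o then e (some ⟨o, entry (f o)⟩) else x)
  | .loop _ _ f, e, _, some ⟨a, l⟩ => compile (f a) (fun l => e (some ⟨a, l⟩)) (e none) l

/-- Configurations of the machines that run programs. -/
abbrev MCfg (L : Type) : Type := Turing.TM2.Cfg (fun _ : Stack => Sym) L (Option Sym)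

/-- `t` steps lead from `a` to `b`. -/
def Steps {L : Type} (M : L → MStmt L) (t : ℕ) (a b : MCfg L) : Prop :=
  (flip bind (Turing.TM2.step M))^[t] (some a) = some b

theorem Steps.trans {L : Type} {M : L → MStmt L} {t u : ℕ} {a b c : MCfg L}
    (h : Steps M t a b) (h' : Steps M u b c) : Steps M (t + u) a c := by
  unfold Steps at *
  rw [Nat.add_comm, Function.iterate_add_apply, h, h']

theorem Steps.one {L : Type} {M : L → MStmt L} {l : L} {s : MStmt L} (h : M l = s)
    (v : Option Sym) (S : Store) : Steps M 1 ⟨some l, v, S⟩ (Turing.TM2.stepAux s v S) := by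
  subst h; rfl

/-- Induction on the execution rather than on the program, because a run of a loop contains a run of
the same loop. The embedding `e` and the exit `x` vary, so that the induction hypotheses apply to
subprograms inside the same machine; the exit of a loop body is the label of the loop test. -/
theorem Exec.steps {c : Cmd} {S S' : Store} {t : ℕ} (h : Exec c S S' t) {L : Type}
    (M : L → MStmt L) (e : Lab c → L) (x : L) (hM : ∀ l, M (e l) = compile c e x l)
    (v : Option Sym) : ∃ v', Steps M t ⟨some (e (entry c)), v, S⟩ ⟨some x, v', S'⟩ := by
  induction h generalizing x v with
  | skip S => exact ⟨v, .one (hM _) v S⟩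
  | push k a S => exact ⟨v, .one (hM _) v S⟩
  | @seq c d S S' S'' t u _ _ ih1 ih2 =>
    obtain ⟨v1, h1⟩ := ih1 (fun l => e (.inl l)) (e (.inr (entry d))) (fun l => hM (.inl l)) v
    obtain ⟨v2, h2⟩ := ih2 (fun l => e (.inr l)) x (fun l => hM (.inr l)) v1
    exact ⟨v2, h1.trans h2⟩
  | @case k f S S' t _ ih =>
    obtain ⟨v1, h1⟩ := ih (fun l => e (some ⟨_, l⟩)) x (fun l => hM (some ⟨_, l⟩)) (S k).head?
    refine ⟨v1, ?_⟩
    rw [Nat.add_comm]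
    exact (Steps.one (hM none) v S).trans h1
  | @loop_done k p f S hp =>
    have h := Steps.one (hM none) v S
    simp only [compile, Turing.TM2.stepAux, hp] at h
    exact ⟨(S k).head?, h⟩
  | @loop_step k p f S S' S'' t u hp _ _ ih1 ih2 =>
    obtain ⟨v1, h1⟩ := ih1 (fun l => e (some ⟨_, l⟩)) (e none) (fun l => hM (some ⟨_, l⟩))
      (S k).head?
    obtain ⟨v2, h2⟩ := ih2 e x hM v1
    refine ⟨v2, ?_⟩
    rw [Nat.add_comm]
    have h := Steps.one (hM none) v S
    simp only [compile, Turing.TM2.stepAux, hp] at h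
    exact Steps.trans h (h1.trans h2)

/-- The machine that runs a program, with `tmp` as input and output stack. -/
noncomputable def machine (c : Cmd) : Turing.FinTM2 where
  K := Stack
  k₀ := .tmp
  k₁ := .tmp
  Γ _ := Sym
  Λ := Option (Lab c)
  main := some (entry c)
  ΛFin := @Fintype.ofFinite _ inferInstance
  σ := Option Sym
  initialState := none
  m
    | some l => compile c some none l
    -- A halting configuration must have the initial internal state, so the last popped symbol is
    -- erased.
    | none => .load (fun _ => none) .halt

theorem machine_outputs {c : Cmd} {i o : List Sym} {t : ℕ}
    (h : Exec c (mkStore [] [] [] i) (mkStore [] [] [] o) t) {T : ℕ} (hT : t + 1 ≤ T) :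
    Nonempty (Turing.TM2OutputsInTime (machine c) i (some o) T) := by
  obtain ⟨v, hv⟩ := h.steps (machine c).m some none (fun _ => rfl) none
  have h2 : Steps (machine c).m 1 ⟨some none, v, mkStore [] [] [] o⟩
      ⟨none, none, mkStore [] [] [] o⟩ := .one rfl _ _
  have h3 := hv.trans h2
  have hi : ∀ s, mkStore [] [] [] s = (Turing.initList (machine c) s).stk := by
    intro s; funext k; cases k <;> rfl
  have ho : ∀ s, mkStore [] [] [] s = (Turing.haltList (machine c) s).stk := by
    intro s; funext k; cases k <;> rfl
  rw [hi, ho] at h3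
  exact ⟨⟨⟨t + 1, h3⟩, hT⟩⟩

@[simp] theorem mkStore_main (m a c d : List Sym) : mkStore m a c d .main = m := rfl
@[simp] theorem mkStore_aux (m a c d : List Sym) : mkStore m a c d .aux = a := rfl
@[simp] theorem mkStore_ctr (m a c d : List Sym) : mkStore m a c d .ctr = c := rfl
@[simp] theorem mkStore_tmp (m a c d : List Sym) : mkStore m a c d .tmp = d := rfl

@[simp] theorem update_main (m a c d x : List Sym) :
    update (mkStore m a c d) .main x = mkStore x a c d := by
  funext k; cases k <;> rfl
@[simp] theorem update_aux (m a c d x : List Sym) :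
    update (mkStore m a c d) .aux x = mkStore m x c d := by
  funext k; cases k <;> rfl
@[simp] theorem update_ctr (m a c d x : List Sym) :
    update (mkStore m a c d) .ctr x = mkStore m a x d := by
  funext k; cases k <;> rfl
@[simp] theorem update_tmp (m a c d x : List Sym) :
    update (mkStore m a c d) .tmp x = mkStore m a c x := by
  funext k; cases k <;> rfl

/-- The number of symbols in a store. -/
def total (S : Store) : ℕ :=
  (S .main).length + (S .aux).length + (S .ctr).length + (S .tmp).length

/-- One step pushes at most one symbol. Time bounds therefore bound the size of results as well,
which is what composition of programs needs. -/
theorem Exec.total_le {c : Cmd} {S S' : Store} {t : ℕ} (h : Exec c S S' t) :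
    total S' ≤ total S + t := by
  have key : ∀ (S : Store) (k : Stack), total (update S k (S k).tail) ≤ total S := by
    intro S k
    cases k <;> simp [total, Function.update]
  induction h with
  | skip S => omega
  | push k a S => cases k <;> simp only [total, Function.update] <;> simp <;> omega
  | seq _ _ ih1 ih2 => omega
  | @case k f S _ _ _ ih => have := key S k; omega
  | @loop_done k p f S hp => have := key S k; omega
  | @loop_step k p f S _ _ _ _ hp _ _ ih1 ih2 => have := key S k; omega

/-! ### Binary trees on the stacks -/

/-- Binary trees, the data of polynomial-time programs. -/
inductive BTree : Type
  | leaf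
  | node (l r : BTree)

/-- The prefix code of a tree. -/
def BTree.code : BTree → List Sym
  | .leaf => [some false]
  | .node l r => some true :: (l.code ++ r.code)

theorem BTree.isSome_of_mem_code {x : BTree} {s : Sym} (h : s ∈ x.code) : s.isSome := by
  induction x with
  | leaf => simp_all [code]
  | node l r hl hr =>
    simp only [code, List.mem_cons, List.mem_append] at h
    rcases h with rfl | h | h
    exacts [rfl, hl h, hr h]

theorem BTree.length_code_pos (x : BTree) : 0 < x.code.length := by
  cases x <;> simp [code]

/-- `c` transforms the work stack and the auxiliary stack in at most `T` steps. -/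
def Run (c : Cmd) (m a m' a' : List Sym) (T : ℕ) : Prop :=
  ∃ t ≤ T, Exec c (mkStore m a [] []) (mkStore m' a' [] []) t

section Run

variable {c d : Cmd} {m a m' a' m'' a'' : List Sym} {T U : ℕ}

theorem Run.mono (h : Run c m a m' a' T) (hT : T ≤ U) : Run c m a m' a' U :=
  let ⟨t, ht, h⟩ := h
  ⟨t, ht.trans hT, h⟩

theorem Run.seq (h : Run c m a m' a' T) (h' : Run d m' a' m'' a'' U) :
    Run (c ;; d) m a m'' a'' (T + U) :=
  let ⟨t, ht, h⟩ := h
  let ⟨u, hu, h'⟩ := h'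
  ⟨t + u, by omega, h.seq h'⟩

theorem Run.skip : Run .skip m a m a 1 := ⟨1, le_rfl, .skip _⟩

theorem Run.push (s : Sym) : Run (.push .main s) m a (s :: m) a 1 :=
  ⟨1, le_rfl, by simpa using Exec.push .main s (mkStore m a [] [])⟩

theorem Run.case {f : Option Sym → Cmd} {s : Sym} (h : Run (f (some s)) m a m' a' T) :
    Run (.case .main f) (s :: m) a m' a' (T + 1) :=
  let ⟨t, ht, h⟩ := h
  ⟨t + 1, by omega, .case (by simpa using h)⟩

theorem Run.length_le (h : Run c m a m' a' T) :
    m'.length + a'.length ≤ m.length + a.length + T := by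
  obtain ⟨t, ht, h⟩ := h
  have := h.total_le
  simp [total] at this
  omega

/-- Push a word, first symbol on top. -/
def pushWord : List Sym → Cmd
  | [] => .skip
  | s :: w => pushWord w ;; .push .main s

theorem Run.pushWord (w : List Sym) : Run (pushWord w) m a (w ++ m) a (w.length + 1) := by
  induction w with
  | nil => exact .skip
  | cons s w ih => exact ih.seq (.push s)

end Run

/-- Traverse the tree on top of the work stack and move it, reversed, to the auxiliary stack if
`p` and to the copy buffer if `q`. -/
def walkLoop (p q : Bool) : Cmd :=
  -- The counter holds one symbol for each subtree still to be read. Every symbol read removes one,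
  -- and a node symbol adds two, so the loop stops exactly at the end of the tree.
  .loop .ctr (·.isSome) fun _ => .case .main fun o =>
    (if p then .push .aux (o.getD none) else .skip) ;;
    (if q then .push .tmp (o.getD none) else .skip) ;;
    (if o = some (some true) then .push .ctr none ;; .push .ctr none else .skip)

theorem exec_walkLoop_step (p q : Bool) (s : Sym) {m a c d : List Sym} {S : Store} {t : ℕ}
    (h : Exec (walkLoop p q) (mkStore m ((if p then [s] else []) ++ a)
      ((if some s = some (some true) then [none, none] else []) ++ c)
      ((if q then [s] else []) ++ d)) S t) :
    ∃ u ≤ t + 6, Exec (walkLoop p q) (mkStore (s :: m) a (none :: c) d) S u := by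
  have h1 : Exec (if p then .push .aux s else .skip) (mkStore m a c d)
      (mkStore m ((if p then [s] else []) ++ a) c d) 1 := by
    cases p
    · exact .skip _
    · simpa using Exec.push .aux s (mkStore m a c d)
  have h2 : Exec (if q then .push .tmp s else .skip) (mkStore m ((if p then [s] else []) ++ a) c d)
      (mkStore m ((if p then [s] else []) ++ a) c ((if q then [s] else []) ++ d)) 1 := by
    cases q
    · exact .skip _
    · simpa using Exec.push .tmp s (mkStore m ((if p then [s] else []) ++ a) c d)
  have hpush : ∀ (m a c d : List Sym), Exec (.push .ctr none) (mkStore m a c d)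
      (mkStore m a (none :: c) d) 1 := fun m a c d => by
    simpa using Exec.push .ctr none (mkStore m a c d)
  obtain ⟨v, hv, h3⟩ : ∃ v ≤ 2, Exec
      (if some s = some (some true) then .push .ctr none ;; .push .ctr none else .skip)
      (mkStore m ((if p then [s] else []) ++ a) c ((if q then [s] else []) ++ d))
      (mkStore m ((if p then [s] else []) ++ a)
        ((if some s = some (some true) then [none, none] else []) ++ c)
        ((if q then [s] else []) ++ d)) v := by
    by_cases hs : some s = some (some true)
    · simp only [if_pos hs]
      exact ⟨1 + 1, le_rfl, (hpush _ _ _ _).seq (hpush _ _ _ _)⟩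
    · simp only [if_neg hs]
      exact ⟨1, by omega, .skip _⟩
  exact ⟨1 + (1 + v) + 1 + t + 1, by omega,
    .loop_step (by simp) (.case (by simpa using h1.seq (h2.seq h3))) h⟩

/-- Formulated with a continuation: `h` is the rest of the loop after the tree has been read. A node
is then handled by prefixing to `h` the run on the right subtree, then on the left one, then the
node symbol. -/
theorem exec_walkLoop (p q : Bool) (x : BTree) {m a c d : List Sym} {S : Store} {t : ℕ}
    (h : Exec (walkLoop p q) (mkStore m ((if p then x.code.reverse else []) ++ a) c
      ((if q then x.code.reverse else []) ++ d)) S t) :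
    ∃ u ≤ t + 6 * x.code.length,
      Exec (walkLoop p q) (mkStore (x.code ++ m) a (none :: c) d) S u := by
  induction x generalizing m a c d S t with
  | leaf =>
    obtain ⟨u, hu, h⟩ := exec_walkLoop_step p q (some false) (m := m) (a := a) (c := c) (d := d)
      (by simpa [BTree.code] using h)
    exact ⟨u, hu, h⟩
  | node l r hl hr =>
    obtain ⟨u, hu, h⟩ := hr (a := (if p then l.code.reverse else []) ++
      ((if p then [some true] else []) ++ a)) (d := (if q then l.code.reverse else []) ++
      ((if q then [some true] else []) ++ d)) (m := m) (c := c) (S := S) (t := t)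
      (by cases p <;> cases q <;> simpa [BTree.code] using h)
    obtain ⟨u', hu', h⟩ := hl h
    obtain ⟨u'', hu'', h⟩ := exec_walkLoop_step p q (some true) h
    refine ⟨u'', ?_, by simpa [BTree.code] using h⟩
    simp [BTree.code]; omega

/-- Traverse a tree with the given effects. -/
def walk (p q : Bool) : Cmd := .push .ctr none ;; walkLoop p q

theorem exec_walk (p q : Bool) (x : BTree) (m a d : List Sym) :
    ∃ u ≤ 6 * x.code.length + 2, Exec (walk p q) (mkStore (x.code ++ m) a [] d)
      (mkStore m ((if p then x.code.reverse else []) ++ a) []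
        ((if q then x.code.reverse else []) ++ d)) u := by
  obtain ⟨u, hu, h⟩ := exec_walkLoop p q x (m := m) (a := a) (c := []) (d := d)
    (.loop_done (by simp))
  refine ⟨_, ?_, .seq (by simpa using Exec.push .ctr none (mkStore (x.code ++ m) a [] d))
    (by simpa using h)⟩
  omega

/-- Remove the tree on top of the work stack. -/
def drop : Cmd := walk false false

theorem Run.drop (x : BTree) (m a : List Sym) :
    Run drop (x.code ++ m) a m a (6 * x.code.length + 2) := by
  exact exec_walk false false x m a []

/-- Move the tree on top of the work stack to the auxiliary stack. -/
def save : Cmd := .push .aux none ;; walk true false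

/-- The form in which a tree is stored on the auxiliary stack. -/
def BTree.saved (x : BTree) : List Sym := x.code.reverse ++ [none]

theorem Run.save (x : BTree) (m a : List Sym) :
    Run save (x.code ++ m) a m (x.saved ++ a) (6 * x.code.length + 3) := by
  obtain ⟨u, hu, h⟩ := exec_walk true false x m (none :: a) []
  refine ⟨_, ?_, .seq (by simpa using Exec.push .aux none (mkStore (x.code ++ m) a [] []))
    (by simpa [BTree.saved] using h)⟩
  omega

/-- Move the last saved tree back to the work stack. -/
def restore : Cmd :=
  -- A saved tree ends with the mark `none`, which no tree code contains. The failing test of the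
  -- loop also removes it.
  .loop .aux (fun o => (o.getD none).isSome) fun o => .push .main (o.getD none)

theorem exec_restore (w : List Sym) (hw : ∀ s ∈ w, s.isSome) (m a d : List Sym) :
    Exec restore (mkStore m (w ++ none :: a) [] d) (mkStore (w.reverse ++ m) a [] d)
      (2 * w.length + 1) := by
  induction w generalizing m with
  | nil =>
    have h := Exec.loop_done (k := .aux) (p := fun o => (o.getD none).isSome)
      (f := fun o => .push .main (o.getD none)) (S := mkStore m (none :: a) [] d) (by simp)
    simpa [restore] using h
  | cons s w ih =>
    have hs : s.isSome := hw s (by simp)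
    have h2 := ih (fun s h => hw s (by simp [h])) (s :: m)
    have h3 := Exec.push .main s (mkStore m (w ++ none :: a) [] d)
    have h4 := Exec.loop_step (k := .aux) (p := fun o => (o.getD none).isSome)
      (f := fun o => .push .main (o.getD none)) (S := mkStore m (s :: w ++ none :: a) [] d)
      (by simpa using hs) (by simpa using h3) h2
    have e1 : (s :: w).reverse ++ m = w.reverse ++ s :: m := by simp
    have e2 : 2 * (s :: w).length + 1 = 1 + (2 * w.length + 1) + 1 := by simp; omega
    rw [e1, e2]
    exact h4

theorem Run.restore (x : BTree) (m a : List Sym) :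
    Run restore m (x.saved ++ a) (x.code ++ m) a (2 * x.code.length + 1) := by
  have h := exec_restore x.code.reverse
    (fun s hs => BTree.isSome_of_mem_code (List.mem_reverse.1 hs)) m a []
  exact ⟨_, le_rfl, by simpa [BTree.saved] using h⟩

/-- Move the copy buffer to the work stack. -/
def drain : Cmd := .loop .tmp (·.isSome) fun o => .push .main (o.getD none)

theorem exec_drain (w m a : List Sym) :
    Exec drain (mkStore m a [] w) (mkStore (w.reverse ++ m) a [] []) (2 * w.length + 1) := by
  induction w generalizing m with
  | nil =>
    have h := Exec.loop_done (k := .tmp) (p := fun o => o.isSome)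
      (f := fun o => .push .main (o.getD none)) (S := mkStore m a [] []) (by simp)
    simpa [drain] using h
  | cons s w ih =>
    have h3 := Exec.push .main s (mkStore m a [] w)
    have h4 := Exec.loop_step (k := .tmp) (p := fun o => o.isSome)
      (f := fun o => .push .main (o.getD none)) (S := mkStore m a [] (s :: w))
      (by simp) (by simpa using h3) (ih (s :: m))
    have e1 : (s :: w).reverse ++ m = w.reverse ++ s :: m := by simp
    have e2 : 2 * (s :: w).length + 1 = 1 + (2 * w.length + 1) + 1 := by simp; omega
    rw [e1, e2]
    exact h4

/-- Duplicate the tree on top of the work stack. -/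
def dup : Cmd := .push .aux none ;; walk true true ;; drain ;; restore

theorem Run.dup (x : BTree) (m a : List Sym) :
    Run dup (x.code ++ m) a (x.code ++ (x.code ++ m)) a (10 * x.code.length + 5) := by
  obtain ⟨u, hu, h⟩ := exec_walk true true x m (none :: a) []
  have h1 := Exec.push .aux none (mkStore (x.code ++ m) a [] [])
  simp only [mkStore_aux, update_aux] at h1
  have h3 := exec_drain x.code.reverse m (x.saved ++ a)
  obtain ⟨t, ht, h4⟩ := Run.restore x (x.code ++ m) a
  rw [List.length_reverse] at h3
  refine ⟨_, ?_, h1.seq (h.seq (.seq (by simpa [BTree.saved] using h3) h4))⟩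
  omega

/-! ### Functions computable in polynomial time on encoded data -/

/-- Encodings as binary trees. -/
class Enc (α : Type) where
  enc : α → BTree

open Enc (enc)

/-- The two truth values have codes of the same length. -/
instance : Enc Bool :=
  ⟨fun b => cond b (.node (.node .leaf .leaf) .leaf) (.node .leaf (.node .leaf .leaf))⟩

instance {α β : Type} [Enc α] [Enc β] : Enc (α × β) := ⟨fun p => .node (enc p.1) (enc p.2)⟩

/-- Lists are encoded as nested pairs. -/
def encList {α : Type} [Enc α] : List α → BTree
  | [] => .leaf
  | a :: l => .node (enc a) (encList l)

instance {α : Type} [Enc α] : Enc (List α) := ⟨encList⟩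

instance : Enc ℕ := ⟨fun n => enc n.bits⟩

instance : Enc Sym := ⟨fun s => enc (s.isNone, s.getD false)⟩

/-- The size of the encoding. -/
def esize {α : Type} [Enc α] (x : α) : ℕ := (enc x).code.length

section

variable {α β γ δ : Type} [Enc α] [Enc β] [Enc γ] [Enc δ]

theorem esize_pos (x : α) : 0 < esize x := (enc x).length_code_pos

@[simp] theorem esize_pair (a : α) (b : β) : esize (a, b) = esize a + esize b + 1 := by
  simp [esize, enc, BTree.code]

@[simp] theorem esize_nil : esize ([] : List α) = 1 := rfl

@[simp] theorem esize_cons (a : α) (l : List α) : esize (a :: l) = esize a + esize l + 1 := by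
  simp [esize, enc, BTree.code, encList]

@[simp] theorem esize_bool (b : Bool) : esize b = 5 := by cases b <;> rfl

@[simp] theorem esize_sym (s : Sym) : esize s = 11 := by
  change esize (s.isNone, s.getD false) = 11
  simp

theorem esize_append (l l' : List α) : esize (l ++ l') + 1 = esize l + esize l' := by
  induction l with
  | nil => simp; omega
  | cons a l ih => simp only [List.cons_append, esize_cons]; omega

theorem length_lt_esize (l : List α) : l.length < esize l := by
  induction l with
  | nil => simp
  | cons a l ih => simp; omega

theorem esize_bits (l : List Bool) : esize l = 6 * l.length + 1 := by
  induction l with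
  | nil => rfl
  | cons a l ih => simp; omega

theorem esize_nat (n : ℕ) : esize n = 6 * n.size + 1 := by
  change esize n.bits = _
  rw [esize_bits, Nat.size_eq_bits_len]

theorem esize_nat_mono {a b : ℕ} (h : a ≤ b) : esize a ≤ esize b := by
  have := Nat.size_le_size h
  simp only [esize_nat]
  omega

/-- Bounded by a polynomial in the size of the encoding. -/
def PolyB (b : α → ℕ) : Prop := ∃ e, ∀ x, b x ≤ (esize x + 2) ^ e

protected theorem PolyB.of_le {b b' : α → ℕ} (h : PolyB b) (h' : ∀ x, b' x ≤ b x) : PolyB b' :=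
  let ⟨e, h⟩ := h
  ⟨e, fun x => (h' x).trans (h x)⟩

/-- The summand 2 in the base of the bound makes n < 2 ^ n sufficient here. -/
protected theorem PolyB.const (n : ℕ) : PolyB fun _ : α => n :=
  ⟨n, fun x => Nat.lt_two_pow_self.le.trans (Nat.pow_le_pow_left (by omega) n)⟩

protected theorem PolyB.esize : PolyB fun x : α => esize x := ⟨1, fun x => by simp⟩

protected theorem PolyB.add {b b' : α → ℕ} (h : PolyB b) (h' : PolyB b') : PolyB fun x => b x + b' x := by
  obtain ⟨e, h⟩ := h
  obtain ⟨e', h'⟩ := h'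
  refine ⟨max e e' + 1, fun x => ?_⟩
  have h1 : (SimShap.esize x + 2) ^ e ≤ (SimShap.esize x + 2) ^ max e e' :=
    Nat.pow_le_pow_right (by omega) (le_max_left _ _)
  have h2 : (SimShap.esize x + 2) ^ e' ≤ (SimShap.esize x + 2) ^ max e e' :=
    Nat.pow_le_pow_right (by omega) (le_max_right _ _)
  rw [pow_succ]
  nlinarith [h x, h' x, Nat.zero_le (SimShap.esize x * (SimShap.esize x + 2) ^ max e e')]

protected theorem PolyB.mul {b b' : α → ℕ} (h : PolyB b) (h' : PolyB b') : PolyB fun x => b x * b' x := by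
  obtain ⟨e, h⟩ := h
  obtain ⟨e', h'⟩ := h'
  exact ⟨e + e', fun x => by rw [pow_add]; exact Nat.mul_le_mul (h x) (h' x)⟩

/-- Used for composition and loops. The bound `b` need not be monotone in the size of its argument,
so it is replaced by a power that dominates it on all arguments of size at most `s x`. -/
protected theorem PolyB.comp_bound {b : β → ℕ} (h : PolyB b) {s : α → ℕ} (hs : PolyB s) :
    ∃ b' : α → ℕ, PolyB b' ∧ ∀ x y, SimShap.esize y ≤ s x → b y ≤ b' x := by
  obtain ⟨e, h⟩ := h
  obtain ⟨e', hs⟩ := hs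
  refine ⟨fun x => (s x + 2) ^ e, ⟨(e' + 1) * e, fun x => ?_⟩,
    fun x y hy => (h y).trans (Nat.pow_le_pow_left (by omega) e)⟩
  rw [pow_mul]
  refine Nat.pow_le_pow_left ?_ e
  have h1 := hs x
  have h2 : 1 ≤ (SimShap.esize x + 2) ^ e' := Nat.one_le_pow _ _ (by omega)
  have h3 := esize_pos x
  rw [pow_succ]
  nlinarith

/-- `f` is computable in polynomial time by a program that leaves the rest of the stacks alone. -/
@[fun_prop]
def PT (f : α → β) : Prop :=
  ∃ (c : Cmd) (b : α → ℕ), PolyB b ∧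
    ∀ x m a, Run c ((enc x).code ++ m) a ((enc (f x)).code ++ m) a (b x)

/-- A program cannot write more symbols than it makes steps. -/
protected theorem PT.polyB_esize {f : α → β} (h : PT f) : PolyB fun x => esize (f x) := by
  obtain ⟨c, b, hb, h⟩ := h
  refine (PolyB.esize.add hb).of_le fun x => ?_
  have := (h x [] []).length_le
  simpa [SimShap.esize] using this

protected theorem PT.of_enc_eq {f : α → β} (h : ∀ x, enc (f x) = enc x) : PT f :=
  ⟨.skip, fun _ => 1, .const 1, fun x m a => by rw [h]; exact .skip⟩

@[fun_prop]
protected theorem PT.identity : PT fun x : α => x := .of_enc_eq fun _ => rfl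

@[fun_prop]
protected theorem PT.const (y : β) : PT fun _ : α => y :=
  ⟨drop ;; pushWord (enc y).code, fun x => (6 * esize x + 2) + (esize y + 1),
    (((PolyB.const 6).mul .esize).add (.const 2)).add (.const _),
    fun x m a => (Run.drop (enc x) m a).seq (.pushWord _)⟩

@[fun_prop]
protected theorem PT.comp {g : β → γ} {f : α → β} (hg : PT g) (hf : PT f) : PT fun x => g (f x) := by
  have hs := hf.polyB_esize
  obtain ⟨c, b, hb, hf⟩ := hf
  obtain ⟨d, b', hb', hg⟩ := hg
  obtain ⟨b'', hb'', h⟩ := hb'.comp_bound hs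
  exact ⟨c ;; d, fun x => b x + b'' x, hb.add hb'', fun x m a =>
    (hf x m a).seq ((hg (f x) m a).mono (h x (f x) le_rfl))⟩

@[fun_prop]
protected theorem PT.prodMk {f : α → β} {g : α → γ} (hf : PT f) (hg : PT g) : PT fun x => (f x, g x) := by
  have hs := hf.polyB_esize
  have hs' := hg.polyB_esize
  obtain ⟨c, b, hb, hf⟩ := hf
  obtain ⟨d, b', hb', hg⟩ := hg
  -- The value of `f` is computed on a copy and waits on the auxiliary stack while `g` is computed
  -- on the original. The final node symbol turns the two adjacent codes into the code of the pair.
  refine ⟨dup ;; c ;; save ;; d ;; restore ;; .push .main (some true), fun x => (10 * esize x + 5) +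
    (b x + ((6 * esize (f x) + 3) + (b' x + ((2 * esize (f x) + 1) + 1)))),
    (((PolyB.const 10).mul .esize).add (.const 5)).add (hb.add
      ((((PolyB.const 6).mul hs).add (.const 3)).add
      (hb'.add ((((PolyB.const 2).mul hs).add (.const 1)).add (.const 1))))), fun x m a => ?_⟩
  refine (Run.dup _ _ _).seq ((hf _ _ _).seq ((Run.save _ _ _).seq ((hg _ _ _).seq
    ((Run.restore _ _ _).seq ?_))))
  simpa [enc, BTree.code] using Run.push (some true)

@[fun_prop]
protected theorem PT.fst : PT fun x : α × β => x.1 := by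
  refine ⟨.case .main fun _ => save ;; drop ;; restore,
    fun x => (6 * esize x + 3) + ((6 * esize x + 2) + (2 * esize x + 1)) + 1,
    ((((PolyB.const 6).mul .esize).add (.const 3)).add ((((PolyB.const 6).mul .esize).add
      (.const 2)).add (((PolyB.const 2).mul .esize).add (.const 1)))).add (.const 1), ?_⟩
  rintro ⟨x, y⟩ m a
  simp only [enc, BTree.code, List.cons_append, List.append_assoc]
  refine Run.case ((Run.mono (Run.save _ _ _) ?_).seq ((Run.mono (Run.drop _ _ _) ?_).seq
    (Run.mono (Run.restore _ _ _) ?_))) <;> rw [esize_pair] <;> simp only [esize] <;> omega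

@[fun_prop]
protected theorem PT.snd : PT fun x : α × β => x.2 := by
  refine ⟨.case .main fun _ => drop, fun x => (6 * esize x + 2) + 1,
    (((PolyB.const 6).mul .esize).add (.const 2)).add (.const 1), ?_⟩
  rintro ⟨x, y⟩ m a
  simp only [enc, BTree.code, List.cons_append, List.append_assoc]
  refine Run.case (Run.mono (Run.drop _ _ _) ?_)
  rw [esize_pair]
  simp only [esize]
  omega

/-- Pop a given number of symbols. -/
def popMany : ℕ → Cmd
  | 0 => .skip
  | n + 1 => .case .main fun _ => popMany n

theorem Run.popMany (w m a : List Sym) : Run (popMany w.length) (w ++ m) a m a (w.length + 1) := by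
  induction w with
  | nil => exact .skip
  | cons s w ih => exact .case ih

-- The test is evaluated on a copy of the argument. The codes of the truth values have five symbols
-- and first differ in the second, so two pops decide and three more remove the rest.
@[fun_prop]
protected theorem PT.cond {p : α → Bool} {f g : α → β} (hp : PT p) (hf : PT f) (hg : PT g) :
    PT fun x => bif p x then f x else g x := by
  obtain ⟨c, b, hb, hp⟩ := hp
  obtain ⟨d, b', hb', hf⟩ := hf
  obtain ⟨e, b'', hb'', hg⟩ := hg
  refine ⟨dup ;; c ;; .case .main fun _ => .case .main fun o =>
    popMany 3 ;; if o = some (some true) then d else e,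
    fun x => (10 * esize x + 5) + (b x + (4 + (b' x + b'' x) + 1 + 1)),
    (((PolyB.const 10).mul .esize).add (.const 5)).add (hb.add (((((PolyB.const 4).add
      (hb'.add hb'')).add (.const 1)).add (.const 1)))), fun x m a => ?_⟩
  refine (Run.dup _ _ _).seq ((hp _ _ _).seq ?_)
  beta_reduce
  cases p x
  · exact Run.case (Run.case ((Run.popMany [some true, some false, some false] _ _).seq
      (Run.mono (c := e) (hg x m a) (Nat.le_add_left _ _))))
  · exact Run.case (Run.case ((Run.popMany [some false, some false, some false] _ _).seq
      (Run.mono (c := d) (hf x m a) (Nat.le_add_right _ _))))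

@[fun_prop]
protected theorem PT.cons {f : α → β} {g : α → List β} (hf : PT f) (hg : PT g) :
    PT fun x => f x :: g x :=
  PT.comp (g := fun p : β × List β => p.1 :: p.2) (.of_enc_eq fun _ => rfl) (hf.prodMk hg)

protected theorem PT.list_tail : PT fun l : List α => l.tail := by
  refine ⟨.case .main fun o => if o = some (some true) then drop else .push .main (some false),
    fun x => (6 * esize x + 2) + 1,
    (((PolyB.const 6).mul .esize).add (.const 2)).add (.const 1), ?_⟩
  rintro (_ | ⟨x, l⟩) m a
  · exact Run.case ((Run.push _).mono (by omega))
  · simp only [enc, encList, BTree.code, List.cons_append, List.append_assoc]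
    refine Run.case (Run.mono (Run.drop _ _ _) ?_)
    simp [esize, enc, encList, BTree.code]
    omega

@[fun_prop]
protected theorem PT.tail {f : α → List β} (hf : PT f) : PT fun x => (f x).tail := PT.list_tail.comp hf

protected theorem PT.list_headD (d : α) : PT fun l : List α => l.headD d := by
  refine ⟨.case .main fun o => if o = some (some true) then save ;; drop ;; restore
    else pushWord (enc d).code,
    fun x => (6 * esize x + 3) + ((6 * esize x + 2) + (2 * esize x + 1)) + esize d + 1,
    (((((PolyB.const 6).mul .esize).add (.const 3)).add ((((PolyB.const 6).mul .esize).add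
      (.const 2)).add (((PolyB.const 2).mul .esize).add (.const 1)))).add (.const _)).add
      (.const 1), ?_⟩
  rintro (_ | ⟨x, l⟩) m a
  · exact Run.case ((Run.pushWord _).mono (by simp only [esize]; omega))
  · simp only [enc, encList, BTree.code, List.cons_append, List.append_assoc]
    refine (Run.case ((Run.mono (Run.save _ _ _) le_rfl).seq ((Run.mono (Run.drop _ _ _)
      le_rfl).seq (Run.mono (Run.restore _ _ _) le_rfl)))).mono ?_
    simp [esize, enc, encList, BTree.code]
    omega

@[fun_prop]
protected theorem PT.headD {f : α → List β} (hf : PT f) (d : β) : PT fun x => (f x).headD d :=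
  (PT.list_headD d).comp hf

protected theorem PT.list_isEmpty : PT fun l : List α => l.isEmpty := by
  -- The popped symbol is put back so that `drop` finds a complete tree.
  refine ⟨.case .main fun o => if o = some (some true) then .push .main o.get! ;; drop ;;
    pushWord (enc false).code else pushWord (enc true).code,
    fun x => (1 + ((6 * esize x + 2) + (esize false + 1))) + 1,
    ((PolyB.const 1).add ((((PolyB.const 6).mul .esize).add (.const 2)).add (.const _))).add
      (.const 1), ?_⟩
  rintro (_ | ⟨x, l⟩) m a
  · exact Run.case ((Run.pushWord _).mono (by simp [esize, enc, BTree.code]; omega))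
  · exact (Run.case ((Run.push _).seq ((Run.drop (enc (x :: l)) _ _).seq (Run.pushWord _))))

@[fun_prop]
protected theorem PT.isEmpty {f : α → List β} (hf : PT f) : PT fun x => (f x).isEmpty :=
  PT.list_isEmpty.comp hf

end

/-! ### Bounded iteration: folds over lists -/

section

variable {α β σ : Type} [Enc α] [Enc β] [Enc σ]

theorem Run.loop_done {p : Option Sym → Bool} {f : Option Sym → Cmd} {s : Sym} {m a : List Sym}
    (hp : p (some s) = false) : Run (.loop .main p f) (s :: m) a m a 1 :=
  ⟨1, le_rfl, by
    have h := Exec.loop_done (k := .main) (f := f) (S := mkStore (s :: m) a [] []) hp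
    simpa using h⟩

theorem Run.loop_step {p : Option Sym → Bool} {f : Option Sym → Cmd} {s : Sym}
    {m a m' a' m'' a'' : List Sym} {T U : ℕ} (hp : p (some s) = true)
    (h : Run (f (some s)) m a m' a' T) (h' : Run (.loop .main p f) m' a' m'' a'' U) :
    Run (.loop .main p f) (s :: m) a m'' a'' (T + U + 1) := by
  obtain ⟨t, ht, h⟩ := h
  obtain ⟨u, hu, h'⟩ := h'
  exact ⟨t + u + 1, by omega, .loop_step (by simpa using hp) (by simpa using h) h'⟩

/-- A fold over a list is computable in polynomial time if its states have polynomial size. -/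
protected theorem PT.foldl {F : α → σ → β → σ} {init : α → σ} {l : α → List β}
    (hF : PT fun p : (α × σ) × β => F p.1.1 p.1.2 p.2) (hi : PT init) (hl : PT l)
    {B : α → ℕ} (hB : PolyB B)
    (hb : ∀ x l₁ l₂, l x = l₁ ++ l₂ → esize (l₁.foldl (F x) (init x)) ≤ B x) :
    PT fun x => (l x).foldl (F x) (init x) := by
  have hG : PT fun p : (β × List β) × (α × σ) => (p.1.2, (p.2.1, F p.2.1 p.2.2 p.1.1)) := by
    have h := hF.comp (f := fun p : (β × List β) × (α × σ) => ((p.2.1, p.2.2), p.1.1))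
      (by fun_prop)
    exact .prodMk (by fun_prop) (.prodMk (by fun_prop) h)
  have h0 : PT fun x => (l x, (x, init x)) := by fun_prop
  have hls := hl.polyB_esize
  obtain ⟨c, b, hbp, hG⟩ := hG
  obtain ⟨d, b₀, hb₀, h0⟩ := h0
  -- The argument of a step has three pair nodes; one is counted in the list, the constant 2 pays
  -- for the others.
  obtain ⟨b', hb', hbb⟩ := hbp.comp_bound ((hls.add (PolyB.esize.add hB)).add (.const 2))
  -- The stack holds the remaining list and, below it, the pair of parameter and state. The test
  -- pops the node symbol of a nonempty list. Pushing it back, with a second one on top, joins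
  -- everything into a single argument for `c`; the last pop separates the new list from the new
  -- pair.
  let loop : Cmd := .loop .main (fun o => o = some (some true)) fun _ =>
    .push .main (some true) ;; .push .main (some true) ;; c ;; .case .main fun _ => .skip
  have hloop : ∀ x m a (l₂ l₁ : List β), l x = l₁ ++ l₂ →
      Run loop ((enc l₂).code ++ ((enc (x, l₁.foldl (F x) (init x))).code ++ m)) a
        ((enc (x, (l x).foldl (F x) (init x))).code ++ m) a (l₂.length * (b' x + 5) + 1) := by
    intro x m a l₂
    induction l₂ with
    | nil =>
      intro l₁ h
      rw [h, List.append_nil]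
      exact (Run.loop_done (by simp)).mono (by omega)
    | cons y l₂ ih =>
      intro l₁ h
      have hy := hG ((y, l₂), (x, l₁.foldl (F x) (init x))) m a
      have hlx : esize (y :: l₂) ≤ esize (l x) := by
        have h1 := esize_append l₁ (y :: l₂)
        have h2 := esize_pos l₁
        rw [h]
        omega
      have hBx := hb x l₁ (y :: l₂) h
      replace hy := hy.mono (hbb x _ (by simp only [esize_pair, esize_cons] at *; omega))
      have h1 := ih (l₁ ++ [y]) (by simpa using h)
      rw [List.foldl_append] at h1
      refine (Run.loop_step (T := 1 + (1 + (b' x + (1 + 1)))) (by simp) ((Run.push _).seq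
        ((Run.push _).seq (Run.seq ?_ (Run.case (s := some true) Run.skip)))) h1).mono ?_
      · simpa [enc, encList, BTree.code] using hy
      · simp only [List.length_cons]
        nlinarith
  have hfin : PT fun x => (x, (l x).foldl (F x) (init x)) := by
    refine ⟨d ;; .case .main fun _ => loop,
      fun x => b₀ x + (esize (l x) * (b' x + 5) + 1 + 1),
      hb₀.add (((hls.mul (hb'.add (.const 5))).add (.const 1)).add (.const 1)), fun x m a => ?_⟩
    refine (h0 x m a).seq ?_
    have h1 := hloop x m a (l x) [] rfl
    have h2 := Run.case (f := fun _ => loop) (s := some true) h1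
    have h3 : l x = [] ++ l x := rfl
    simp only [enc, BTree.code, List.cons_append, List.append_assoc, List.foldl_nil] at h2 ⊢
    exact h2.mono (by have := Nat.mul_le_mul_right (b' x + 5) (length_lt_esize (l x)).le; omega)
  exact PT.snd.comp hfin

omit [Enc α] [Enc σ] in
theorem esize_le_of_mem {a : β} {l : List β} (h : a ∈ l) : esize a ≤ esize l := by
  induction l with
  | nil => simp at h
  | cons b l ih =>
    simp only [List.mem_cons, esize_cons] at h ⊢
    rcases h with rfl | h
    · omega
    · have := ih h
      omega

/-- A fold over a list is computable in polynomial time if each step enlarges the state by a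
polynomial in the size of the parameters and the list element. -/
protected theorem PT.foldl_add {F : α → σ → β → σ} {init : α → σ} {l : α → List β}
    (hF : PT fun p : (α × σ) × β => F p.1.1 p.1.2 p.2) (hi : PT init) (hl : PT l)
    {g : α × β → ℕ} (hg : PolyB g) (hb : ∀ x s a, esize (F x s a) ≤ esize s + g (x, a)) :
    PT fun x => (l x).foldl (F x) (init x) := by
  have hls := hl.polyB_esize
  have his := hi.polyB_esize
  obtain ⟨g', hg', hgg⟩ := hg.comp_bound ((PolyB.esize.add hls).add (.const 1))
  have hmem : ∀ x (a : β), a ∈ l x → g (x, a) ≤ g' x := fun x a ha =>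
    hgg x (x, a) (by have := esize_le_of_mem ha; simp only [esize_pair]; omega)
  refine PT.foldl hF hi hl (his.add (hls.mul hg')) fun x l₁ l₂ h => ?_
  have key : ∀ (l' : List β) s, (∀ a ∈ l', g (x, a) ≤ g' x) →
      esize (l'.foldl (F x) s) ≤ esize s + l'.length * g' x := by
    intro l'
    induction l' with
    | nil => intro s _; simp
    | cons a l' ih =>
      intro s hs
      have h1 := ih (F x s a) fun b hb => hs b (by simp [hb])
      have h2 := hb x s a
      have h3 := hs a (by simp)
      simp only [List.foldl_cons, List.length_cons]
      nlinarith
  refine (key l₁ (init x) fun a ha => hmem x a (by simp [h, ha])).trans ?_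
  have h1 : l₁.length ≤ esize (l x) := by
    have := length_lt_esize (l x)
    simp only [h, List.length_append] at *
    omega
  have := Nat.mul_le_mul_right (g' x) h1
  omega

end

/-! ### Input and output of the machines -/

/-- Turn the input into an encoded list. -/
def readInput : Cmd :=
  (.loop .tmp (·.isSome) fun o => .push .aux (o.getD none)) ;; .push .main (some false) ;;
    -- The last letter is on top of `aux`, so the list is built from its end.
    .loop .aux (·.isSome) fun o => pushWord (enc (o.getD none)).code ;; .push .main (some true)

theorem exec_readInput (i : List Sym) :
    ∃ t ≤ 20 * i.length + 3, Exec readInput (mkStore [] [] [] i)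
      (mkStore (enc i).code [] [] []) t := by
  have h1 : ∀ (i a : List Sym), Exec (.loop .tmp (·.isSome) fun o => .push .aux (o.getD none))
      (mkStore [] a [] i) (mkStore [] (i.reverse ++ a) [] []) (2 * i.length + 1) := by
    intro i
    induction i with
    | nil =>
      intro a
      have h := Exec.loop_done (k := .tmp) (p := fun o => o.isSome)
        (f := fun o => .push .aux (o.getD none)) (S := mkStore [] a [] []) (by simp)
      simpa using h
    | cons s i ih =>
      intro a
      have h3 := Exec.push .aux s (mkStore [] a [] i)
      have h4 := Exec.loop_step (k := .tmp) (p := fun o => o.isSome)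
        (f := fun o => .push .aux (o.getD none)) (S := mkStore [] a [] (s :: i))
        (by simp) (by simpa using h3) (ih (s :: a))
      have e1 : (s :: i).reverse ++ a = i.reverse ++ s :: a := by simp
      have e2 : 2 * (s :: i).length + 1 = 1 + (2 * i.length + 1) + 1 := by simp; omega
      rw [e1, e2]
      exact h4
  have h2 : ∀ (i j : List Sym), ∃ t ≤ 14 * i.length + 1, Exec (.loop .aux (·.isSome) fun o =>
      pushWord (enc (o.getD none)).code ;; .push .main (some true))
      (mkStore (enc j).code i [] []) (mkStore (enc (i.reverse ++ j)).code [] [] []) t := by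
    intro i
    induction i with
    | nil =>
      intro j
      have h := Exec.loop_done (k := .aux) (p := fun o => o.isSome)
        (f := fun o => pushWord (enc (o.getD none)).code ;; .push .main (some true))
        (S := mkStore (enc j).code [] [] []) (by simp)
      exact ⟨1, by simp, by simpa using h⟩
    | cons s i ih =>
      intro j
      obtain ⟨u, hu, h3⟩ := (Run.pushWord (m := (enc j).code) (a := i) (enc s).code).seq
        (Run.push (some true))
      obtain ⟨t, ht, h4⟩ := ih (s :: j)
      have h5 := Exec.loop_step (k := .aux) (p := fun o => o.isSome)
        (f := fun o => pushWord (enc (o.getD none)).code ;; .push .main (some true))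
        (S := mkStore (enc j).code (s :: i) [] []) (by simp)
        (by simpa [enc, encList, BTree.code] using h3) h4
      refine ⟨_, ?_, by simpa using h5⟩
      have : (enc s).code.length = 11 := esize_sym s
      simp only [List.length_cons]
      omega
  obtain ⟨t, ht, h3⟩ := h2 (i.reverse ++ []) []
  have h4 := Exec.push .main (some false) (mkStore [] (i.reverse ++ []) [] [])
  refine ⟨_, ?_, (h1 i []).seq (.seq (by simpa using h4)
    (by simpa [enc, encList, BTree.code] using h3))⟩
  simp at ht
  omega

/-- Turn an encoded list into the output. -/
def writeOutput : Cmd :=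
  -- The code of a letter is a pair node followed by two truth values. Only their second symbols,
  -- `p` and `q`, carry information.
  (.loop .main (fun o => o = some (some true)) fun _ => .case .main fun _ => .case .main fun _ =>
    .case .main fun p => popMany 3 ;; .case .main fun _ => .case .main fun q => popMany 3 ;;
      .push .aux (if p = some (some true) then none else some (q = some (some true)))) ;;
    .loop .aux (·.isSome) fun o => .push .tmp (o.getD none)

theorem exec_writeOutput (o : List Sym) :
    ∃ t ≤ 20 * o.length + 2, Exec writeOutput (mkStore (enc o).code [] [] [])
      (mkStore [] [] [] o) t := by
  have h2 : ∀ (i a : List Sym), Exec (.loop .aux (·.isSome) fun o => .push .tmp (o.getD none))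
      (mkStore [] i [] a) (mkStore [] [] [] (i.reverse ++ a)) (2 * i.length + 1) := by
    intro i
    induction i with
    | nil =>
      intro a
      have h := Exec.loop_done (k := .aux) (p := fun o => o.isSome)
        (f := fun o => .push .tmp (o.getD none)) (S := mkStore [] [] [] a) (by simp)
      simpa using h
    | cons s i ih =>
      intro a
      have h3 := Exec.push .tmp s (mkStore [] i [] a)
      have h4 := Exec.loop_step (k := .aux) (p := fun o => o.isSome)
        (f := fun o => .push .tmp (o.getD none)) (S := mkStore [] (s :: i) [] a)
        (by simp) (by simpa using h3) (ih (s :: a))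
      have e1 : (s :: i).reverse ++ a = i.reverse ++ s :: a := by simp
      have e2 : 2 * (s :: i).length + 1 = 1 + (2 * i.length + 1) + 1 := by simp; omega
      rw [e1, e2]
      exact h4
  have h1 : ∀ (i a : List Sym), Run (.loop .main (fun o => o = some (some true)) fun _ =>
      .case .main fun _ => .case .main fun _ =>
      .case .main fun p => popMany 3 ;; .case .main fun _ => .case .main fun q => popMany 3 ;;
      .push .aux (if p = some (some true) then none else some (q = some (some true))))
      (enc i).code a [] (i.reverse ++ a) (18 * i.length + 1) := by
    intro i
    induction i with
    | nil => exact fun a => Run.loop_done (by simp)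
    | cons s i ih =>
      intro a
      have hpush : ∀ (s : Sym) (m : List Sym), Run (.push .aux s) m a m (s :: a) 1 :=
        fun s m => ⟨1, le_rfl, by simpa using Exec.push .aux s (mkStore m a [] [])⟩
      have e : (s :: i).reverse ++ a = i.reverse ++ s :: a := by simp
      rw [e]
      refine (Run.loop_step (T := 17) (m' := (enc i).code) (a' := s :: a) (by simp) ?_
        (ih (s :: a))).mono (by simp only [List.length_cons]; omega)
      rcases s with _ | _ | _
      · exact (Run.case (Run.case (Run.case ((Run.popMany [_, _, _] _ _).seq (Run.case (Run.case
          ((Run.popMany [_, _, _] _ _).seq (hpush _ _)))))))).mono (by simp)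
      · exact (Run.case (Run.case (Run.case ((Run.popMany [_, _, _] _ _).seq (Run.case (Run.case
          ((Run.popMany [_, _, _] _ _).seq (hpush _ _)))))))).mono (by simp)
      · exact (Run.case (Run.case (Run.case ((Run.popMany [_, _, _] _ _).seq (Run.case (Run.case
          ((Run.popMany [_, _, _] _ _).seq (hpush _ _)))))))).mono (by simp)
  obtain ⟨t, ht, h3⟩ := h1 o []
  have h4 := h2 (o.reverse ++ []) []
  have e : 2 * (o.reverse ++ []).length + 1 = 2 * o.length + 1 := by simp
  rw [e] at h4
  exact ⟨t + (2 * o.length + 1), by omega, h3.seq (by simpa using h4)⟩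

/-- Functions on words that are computable in polynomial time on encoded data are computable
in polynomial time by a Turing machine. -/
protected theorem PT.turing {α β : Type} {ea : α → List Sym} {eb : β → List Sym} {f : α → β}
    {F : List Sym → List Sym} (hF : PT F) (h : ∀ a, F (ea a) = eb (f a)) :
    Nonempty (Turing.TM2ComputableInPolyTime ea eb f) := by
  have hs := hF.polyB_esize
  obtain ⟨c, b, hb, hF⟩ := hF
  -- The constant 6 collects 3 steps of reading, 2 of writing and the halting step.
  obtain ⟨e, he⟩ := (hb.add ((PolyB.const 20).mul hs)).add (.const 6)
  have key : ∀ a (i o : List Sym), i = ea a → o = eb (f a) →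
      Nonempty (Turing.TM2OutputsInTime (machine (readInput ;; c ;; writeOutput)) i (some o)
      ((20 * Polynomial.X + (12 * Polynomial.X + 3) ^ e : Polynomial ℕ).eval (ea a).length)) := by
    rintro a i o rfl rfl
    rw [← h]
    obtain ⟨t, ht, h1⟩ := exec_readInput (ea a)
    obtain ⟨u, hu, h2⟩ := hF (ea a) [] []
    obtain ⟨v, hv, h3⟩ := exec_writeOutput (F (ea a))
    refine machine_outputs (h1.seq (.seq (by simpa using h2) h3)) ?_
    have h4 : b (ea a) + 20 * esize (F (ea a)) + 6 ≤ (esize (ea a) + 2) ^ e := he (ea a)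
    have h5 : esize (ea a) = 12 * (ea a).length + 1 := by
      induction ea a with
      | nil => rfl
      | cons s l ih => simp; omega
    have h6 := length_lt_esize (F (ea a))
    rw [h5, show ∀ n, 12 * n + 1 + 2 = 12 * n + 3 from fun _ => rfl] at h4
    simp only [Polynomial.eval_add, Polynomial.eval_mul, Polynomial.eval_pow, Polynomial.eval_X,
      Polynomial.eval_ofNat]
    omega
  exact ⟨⟨⟨machine (readInput ;; c ;; writeOutput), Equiv.refl _, Equiv.refl _⟩, _,
    fun a => (key a _ _ (List.map_id _) (List.map_id _)).some⟩⟩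

/-! ### Arithmetic and list operations in polynomial time -/

section

variable {α β γ σ : Type} [Enc α] [Enc β] [Enc γ] [Enc σ]

protected theorem PT.congr_enc {f : α → β} {g : α → γ} (hf : PT f) (h : ∀ x, enc (g x) = enc (f x)) :
    PT g := by
  obtain ⟨c, b, hb, hf⟩ := hf
  exact ⟨c, b, hb, fun x m a => by rw [h]; exact hf x m a⟩

protected theorem PT.congr {f g : α → β} (hf : PT f) (h : ∀ x, g x = f x) : PT g := by
  rwa [show g = f from funext h]

@[fun_prop]
protected theorem PT.not {f : α → Bool} (hf : PT f) : PT fun x => !f x :=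
  (PT.cond hf (.const false) (.const true)).congr fun x => by cases f x <;> rfl

@[fun_prop]
protected theorem PT.and {f g : α → Bool} (hf : PT f) (hg : PT g) : PT fun x => f x && g x :=
  (PT.cond hf hg (.const false)).congr fun x => by cases f x <;> rfl

@[fun_prop]
protected theorem PT.or {f g : α → Bool} (hf : PT f) (hg : PT g) : PT fun x => f x || g x :=
  (PT.cond hf (.const true) hg).congr fun x => by cases f x <;> rfl

@[fun_prop]
protected theorem PT.xor {f g : α → Bool} (hf : PT f) (hg : PT g) : PT fun x => Bool.xor (f x) (g x) :=
  (PT.cond hf hg.not hg).congr fun x => by cases f x <;> simp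

protected theorem PT.foldr_add {F : α → β → σ → σ} {init : α → σ} {l : α → List β}
    (hF : PT fun p : (α × σ) × β => F p.1.1 p.2 p.1.2) (hi : PT init)
    (hl : PT fun x => (l x).reverse)
    {g : α × β → ℕ} (hg : PolyB g) (hb : ∀ x a s, esize (F x a s) ≤ esize s + g (x, a)) :
    PT fun x => (l x).foldr (F x) (init x) :=
  (PT.foldl_add (F := fun x s a => F x a s) hF hi hl hg (fun x s a => hb x a s)).congr
    fun x => by rw [List.foldl_reverse]

@[fun_prop]
protected theorem PT.reverse {f : α → List β} (hf : PT f) : PT fun x => (f x).reverse := by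
  refine (PT.foldl_add (F := fun _ s (a : β) => a :: s) (init := fun _ => []) (l := f)
    (g := fun p => esize p.2 + 1) (by fun_prop) (.const _) hf ?_ ?_).congr fun x => ?_
  · exact PT.snd.polyB_esize.add (.const 1)
  · intro _ s a; simp only [esize_cons]; omega
  · have : ∀ (l s : List β), l.reverse ++ s = l.foldl (fun s a => a :: s) s := by
      intro l; induction l with
      | nil => intro s; rfl
      | cons a l ih => intro s; simp [← ih]
    simp [← this]

@[fun_prop]
protected theorem PT.append {f g : α → List β} (hf : PT f) (hg : PT g) : PT fun x => f x ++ g x := by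
  refine (PT.foldr_add (F := fun _ (a : β) s => a :: s) (init := g) (l := f)
    (g := fun p => esize p.2 + 1) (by fun_prop) hg (.reverse hf) ?_ ?_).congr fun x => ?_
  · exact PT.snd.polyB_esize.add (.const 1)
  · intro _ a s; simp only [esize_cons]; omega
  · simp

/-! Natural numbers -/

@[fun_prop]
protected theorem PT.bits {f : α → ℕ} (hf : PT f) : PT fun x => (f x).bits := hf.congr_enc fun _ => rfl

@[fun_prop]
protected theorem PT.bodd {f : α → ℕ} (hf : PT f) : PT fun x => (f x).bodd :=
  (PT.headD hf.bits false).congr fun x => by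
    rw [Nat.bodd_eq_bits_head]; cases (f x).bits <;> rfl

@[fun_prop]
protected theorem PT.div2 {f : α → ℕ} (hf : PT f) : PT fun x => (f x).div2 :=
  hf.bits.tail.congr_enc fun x => by
    change enc (f x).div2.bits = _; rw [Nat.div2_bits_eq_tail]

theorem isEmpty_bits (n : ℕ) : n.bits.isEmpty = (n == 0) := by
  rw [Bool.eq_iff_iff, List.isEmpty_iff, ← List.length_eq_zero_iff, Nat.size_eq_bits_len,
    Nat.size_eq_zero, beq_iff_eq]

@[fun_prop]
protected theorem PT.isZero {f : α → ℕ} (hf : PT f) : PT fun x => f x == 0 :=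
  hf.bits.isEmpty.congr fun _ => (isEmpty_bits _).symm

-- Digit lists have no leading zeros, so appending the digit 0 to the number 0 must leave the list
-- empty; otherwise it is a cons.
@[fun_prop]
protected theorem PT.bit {f : α → Bool} {g : α → ℕ} (hf : PT f) (hg : PT g) :
    PT fun x => Nat.bit (f x) (g x) := by
  have h : PT fun x => bif !f x && (g x).bits.isEmpty then [] else f x :: (g x).bits := by
    fun_prop
  refine h.congr_enc fun x => ?_
  change enc (Nat.bit (f x) (g x)).bits = _
  rw [isEmpty_bits]
  by_cases hx : g x = 0 → f x = true
  · rw [Nat.bits_append_bit _ _ hx]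
    by_cases h0 : g x = 0
    · simp [hx h0]
    · simp [beq_false_of_ne h0]
  · push Not at hx
    simp [hx.1, hx.2]

/-! ### Binary addition and subtraction -/

/-- The number with the given binary digits, most significant digit first. -/
def ofBits (l : List Bool) : ℕ := l.foldl (fun n b => Nat.bit b n) 0

theorem esize_bit_le (b : Bool) (n : ℕ) : esize (Nat.bit b n) ≤ esize n + 6 := by
  by_cases h : Nat.bit b n = 0
  · rw [h]; simp [esize_nat]
  · simp only [esize_nat, Nat.size_bit h]; omega

@[fun_prop]
protected theorem PT.ofBits {f : α → List Bool} (hf : PT f) : PT fun x => ofBits (f x) :=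
  PT.foldl_add (F := fun _ n b => Nat.bit b n) (g := fun _ => 6) (by fun_prop) (.const 0) hf
    (.const 6) fun _ s a => esize_bit_le a s

theorem foldl_bit (l : List Bool) (n : ℕ) :
    l.foldl (fun n b => Nat.bit b n) n = n * 2 ^ l.length + ofBits l := by
  have key : ∀ (l : List Bool) n, l.foldl (fun n b => Nat.bit b n) n =
      n * 2 ^ l.length + l.foldl (fun n b => Nat.bit b n) 0 := by
    intro l
    induction l with
    | nil => simp
    | cons b l ih =>
      intro n
      simp only [List.foldl_cons, List.length_cons]
      rw [ih (Nat.bit b n), ih (Nat.bit b 0), Nat.bit_val, Nat.bit_val]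
      ring
  exact key l n

theorem ofBits_cons (b : Bool) (l : List Bool) :
    ofBits (b :: l) = b.toNat * 2 ^ l.length + ofBits l := by
  change l.foldl _ _ = _
  rw [foldl_bit]
  simp [Nat.bit_val]

theorem ofBits_lt (l : List Bool) : ofBits l < 2 ^ l.length := by
  induction l with
  | nil => simp [ofBits]
  | cons b l ih =>
    rw [ofBits_cons, List.length_cons, pow_succ]
    have := Nat.mul_le_mul_right (2 ^ l.length) b.toNat_le
    omega

/-- One step of addition, or of subtraction if `neg`, of binary numbers, with a carry and the
digits computed so far. -/
def addStep (neg : Bool) (s : (ℕ × ℕ) × (Bool × List Bool)) : (ℕ × ℕ) × (Bool × List Bool) :=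
  ((s.1.1.div2, s.1.2.div2),
    -- The carry is the majority of the two digits and the old carry. Inverting the first digit
    -- gives the borrow of a subtraction; the new digit is the parity in both cases.
    (bif Bool.xor neg s.1.1.bodd then s.1.2.bodd || s.2.1 else s.1.2.bodd && s.2.1,
      Bool.xor (Bool.xor s.1.1.bodd s.1.2.bodd) s.2.1 :: s.2.2))

/-- Addition or subtraction of binary numbers. -/
def addLoop (neg : Bool) (a b : ℕ) : (ℕ × ℕ) × (Bool × List Bool) :=
  -- The list serves only as a clock; its length is enough to exhaust both numbers and the carry.
  (true :: (a.bits ++ b.bits)).foldl (fun s _ => addStep neg s) ((a, b), (false, []))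

theorem esize_addStep_le (neg : Bool) (s : (ℕ × ℕ) × (Bool × List Bool)) :
    esize (addStep neg s) ≤ esize s + 6 := by
  obtain ⟨⟨x, y⟩, c, l⟩ := s
  have h1 : esize x.div2 ≤ esize x := esize_nat_mono (by rw [Nat.div2_val]; omega)
  have h2 : esize y.div2 ≤ esize y := esize_nat_mono (by rw [Nat.div2_val]; omega)
  simp only [addStep, esize_pair, esize_bool, esize_cons]
  omega

protected theorem PT.addLoop (neg : Bool) {f g : α → ℕ} (hf : PT f) (hg : PT g) :
    PT fun x => addLoop neg (f x) (g x) :=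
  PT.foldl_add (F := fun _ s (_ : Bool) => addStep neg s) (g := fun _ => 6)
    (by unfold addStep; fun_prop) (by fun_prop) (by fun_prop) (.const 6)
    fun _ s _ => esize_addStep_le neg s

theorem add_lt_two_pow (a b : ℕ) : a + b < 2 ^ (true :: (a.bits ++ b.bits)).length := by
  have h1 := Nat.lt_size_self a
  have h2 := Nat.lt_size_self b
  have h3 : 1 ≤ 2 ^ a.size := Nat.one_le_two_pow
  have h4 : 1 ≤ 2 ^ b.size := Nat.one_le_two_pow
  simp only [List.length_cons, List.length_append, Nat.size_eq_bits_len, pow_succ, pow_add]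
  nlinarith

theorem addStep_digit (a b c : Bool) :
    (Bool.xor (Bool.xor a b) c).toNat + 2 * (bif Bool.xor false a then b || c else b && c).toNat =
      a.toNat + b.toNat + c.toNat := by
  revert a b c; decide

theorem subStep_digit (a b c : Bool) :
    (Bool.xor (Bool.xor a b) c).toNat + b.toNat + c.toNat =
      a.toNat + 2 * (bif Bool.xor true a then b || c else b && c).toNat := by
  revert a b c; decide

theorem bodd_toNat_add (n : ℕ) : n.bodd.toNat + 2 * n.div2 = n := by
  have := Nat.bodd_add_div2 n
  simpa [Bool.toNat] using this

/-- Invariant: what is left of both numbers plus the carry, shifted by the number of digits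
produced, plus the value of these digits, is a + b. At the end the shift exceeds a + b, so nothing
is left. -/
theorem addLoop_add (a b : ℕ) : ofBits (addLoop false a b).2.2 = a + b := by
  have key : ∀ (l : List Bool) (s : (ℕ × ℕ) × (Bool × List Bool)),
      (s.1.1 + s.1.2 + s.2.1.toNat) * 2 ^ s.2.2.length + ofBits s.2.2 = a + b →
      let s' := l.foldl (fun s _ => addStep false s) s
      (s'.1.1 + s'.1.2 + s'.2.1.toNat) * 2 ^ s'.2.2.length + ofBits s'.2.2 = a + b ∧
        s'.2.2.length = s.2.2.length + l.length := by
    intro l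
    induction l with
    | nil => intro s h; exact ⟨h, rfl⟩
    | cons t l ih =>
      intro s h
      obtain ⟨h1, h2⟩ := ih (addStep false s) (by
        rw [← h]
        simp only [addStep, ofBits_cons, List.length_cons]
        have h1 := addStep_digit s.1.1.bodd s.1.2.bodd s.2.1
        have h2 := bodd_toNat_add s.1.1
        have h3 := bodd_toNat_add s.1.2
        set P := 2 ^ s.2.2.length with hP
        rw [pow_succ, ← hP]
        have h4 : s.1.1 + s.1.2 + s.2.1.toNat = 2 * (s.1.1.div2 + s.1.2.div2 +
          (bif Bool.xor false s.1.1.bodd then s.1.2.bodd || s.2.1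
            else s.1.2.bodd && s.2.1).toNat) +
          (Bool.xor (Bool.xor s.1.1.bodd s.1.2.bodd) s.2.1).toNat := by omega
        rw [h4]
        ring)
      refine ⟨h1, h2.trans ?_⟩
      simp only [addStep, List.length_cons]
      omega
  obtain ⟨h1, h2⟩ := key (true :: (a.bits ++ b.bits)) ((a, b), (false, [])) (by simp [ofBits])
  have h3 := add_lt_two_pow a b
  change _ = _ + _ at h2
  rw [List.length_nil, zero_add] at h2
  rw [h2] at h1
  unfold addLoop
  set s' := List.foldl (fun s _ => addStep false s) ((a, b), (false, []))
    (true :: (a.bits ++ b.bits))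
  rcases Nat.eq_zero_or_pos (s'.1.1 + s'.1.2 + s'.2.1.toNat) with h | h
  · rw [h] at h1; omega
  · have := Nat.mul_le_mul_right (2 ^ (true :: (a.bits ++ b.bits)).length) h
    omega

@[fun_prop]
protected theorem PT.add {f g : α → ℕ} (hf : PT f) (hg : PT g) : PT fun x => f x + g x := by
  have h := PT.addLoop false hf hg
  have h' : PT fun x => SimShap.ofBits (SimShap.addLoop false (f x) (g x)).2.2 := by fun_prop
  exact h'.congr fun x => (addLoop_add _ _).symm

/-- The analogous invariant, with terms moved across the equation to avoid truncated subtraction.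
Once both numbers are used up it reads a + borrow · 2 ^ t = b + digits with digits < 2 ^ t, so a
final borrow means a < b. -/
theorem addLoop_sub (a b : ℕ) :
    (bif (addLoop true a b).2.1 then 0 else ofBits (addLoop true a b).2.2) = a - b := by
  have key : ∀ (l : List Bool) (s : (ℕ × ℕ) × (Bool × List Bool)),
      a + (s.1.2 + s.2.1.toNat) * 2 ^ s.2.2.length =
        b + s.1.1 * 2 ^ s.2.2.length + ofBits s.2.2 →
      s.1.1 * 2 ^ s.2.2.length ≤ a → s.1.2 * 2 ^ s.2.2.length ≤ b →
      let s' := l.foldl (fun s _ => addStep true s) s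
      a + (s'.1.2 + s'.2.1.toNat) * 2 ^ s'.2.2.length =
        b + s'.1.1 * 2 ^ s'.2.2.length + ofBits s'.2.2 ∧
      s'.1.1 * 2 ^ s'.2.2.length ≤ a ∧ s'.1.2 * 2 ^ s'.2.2.length ≤ b ∧
        s'.2.2.length = s.2.2.length + l.length := by
    intro l
    induction l with
    | nil => intro s h h' h''; exact ⟨h, h', h'', rfl⟩
    | cons t l ih =>
      intro s h h' h''
      have e1 := bodd_toNat_add s.1.1
      have e2 := bodd_toNat_add s.1.2
      have halve : ∀ x P u : ℕ, u + 2 * x.div2 = x → x.div2 * (P * 2) ≤ x * P := by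
        intro x P u hx
        rw [show x.div2 * (P * 2) = (2 * x.div2) * P by ring]
        exact Nat.mul_le_mul_right _ (by omega)
      have e3 := subStep_digit s.1.1.bodd s.1.2.bodd s.2.1
      obtain ⟨h1, h2, h3, h4⟩ := ih (addStep true s) (by
        simp only [addStep, ofBits_cons, List.length_cons]
        set P := 2 ^ s.2.2.length with hP
        rw [pow_succ, ← hP]
        generalize (bif Bool.xor true s.1.1.bodd then s.1.2.bodd || s.2.1
            else s.1.2.bodd && s.2.1).toNat = c at *
        generalize (Bool.xor (Bool.xor s.1.1.bodd s.1.2.bodd) s.2.1).toNat = d at *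
        generalize s.1.1.bodd.toNat = u at *
        generalize s.1.2.bodd.toNat = v at *
        have e4 : (2 * (s.1.2.div2 + c) + s.1.1) * P =
            (s.1.2 + s.2.1.toNat + (2 * s.1.1.div2 + d)) * P := by
          congr 1; omega
        nlinarith) (by
          simp only [addStep, List.length_cons, pow_succ]
          exact (halve _ _ _ e1).trans h') (by
          simp only [addStep, List.length_cons, pow_succ]
          exact (halve _ _ _ e2).trans h'')
      refine ⟨h1, h2, h3, h4.trans ?_⟩
      simp only [addStep, List.length_cons]
      omega
  obtain ⟨h1, h2, h3, h4⟩ := key (true :: (a.bits ++ b.bits)) ((a, b), (false, []))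
    (by simp [ofBits]; omega) (by simp) (by simp)
  have h5 := add_lt_two_pow a b
  change _ = _ + _ at h4
  rw [List.length_nil, zero_add] at h4
  unfold addLoop
  set s' := List.foldl (fun s _ => addStep true s) ((a, b), (false, []))
    (true :: (a.bits ++ b.bits))
  have h6 := ofBits_lt s'.2.2
  rw [h4] at h1 h2 h3 h6
  have h7 : s'.1.1 = 0 := by
    by_contra h
    have := Nat.mul_le_mul_right (2 ^ (true :: (a.bits ++ b.bits)).length)
      (Nat.one_le_iff_ne_zero.2 h)
    omega
  have h8 : s'.1.2 = 0 := by
    by_contra h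
    have := Nat.mul_le_mul_right (2 ^ (true :: (a.bits ++ b.bits)).length)
      (Nat.one_le_iff_ne_zero.2 h)
    omega
  rw [h7, h8] at h1
  generalize 2 ^ (true :: (a.bits ++ b.bits)).length = Q at *
  cases hc : s'.2.1 <;> simp [hc] at h1 ⊢ <;> omega

@[fun_prop]
protected theorem PT.sub {f g : α → ℕ} (hf : PT f) (hg : PT g) : PT fun x => f x - g x := by
  have h := PT.addLoop true hf hg
  have h' : PT fun x => bif (SimShap.addLoop true (f x) (g x)).2.1 then 0 else
    SimShap.ofBits (SimShap.addLoop true (f x) (g x)).2.2 := by fun_prop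
  exact h'.congr fun x => (addLoop_sub _ _).symm

end

section

variable {α β γ σ : Type} [Enc α] [Enc β] [Enc γ] [Enc σ]

@[fun_prop]
protected theorem PT.ble {f g : α → ℕ} (hf : PT f) (hg : PT g) : PT fun x => Nat.ble (f x) (g x) :=
  (PT.isZero (hf.sub hg)).congr fun x => by
    rw [Bool.eq_iff_iff, Nat.ble_eq, beq_iff_eq, Nat.sub_eq_zero_iff_le]

@[fun_prop]
protected theorem PT.beq {f g : α → ℕ} (hf : PT f) (hg : PT g) : PT fun x => Nat.beq (f x) (g x) :=
  ((hf.ble hg).and (hg.ble hf)).congr fun x => by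
    rw [Bool.eq_iff_iff, Nat.beq_eq, Bool.and_eq_true, Nat.ble_eq, Nat.ble_eq, le_antisymm_iff]

@[fun_prop]
protected theorem PT.min {f g : α → ℕ} (hf : PT f) (hg : PT g) : PT fun x => min (f x) (g x) :=
  (PT.cond (hf.ble hg) hf hg).congr fun x => by
    by_cases h : f x ≤ g x
    · rw [Nat.ble_eq_true_of_le h, cond_true, min_eq_left h]
    · rw [Bool.eq_false_of_not_eq_true (fun h' => h (Nat.le_of_ble_eq_true h')), cond_false,
        min_eq_right (not_le.1 h).le]

/-! ### Comparison of sizes, multiplication and long division -/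

theorem size_add_le (a b : ℕ) : (a + b).size ≤ a.size + b.size + 1 := by
  have h1 := Nat.lt_size_self a
  have h2 := Nat.lt_size_self b
  have h3 : 1 ≤ 2 ^ a.size := Nat.one_le_two_pow
  have h4 : 1 ≤ 2 ^ b.size := Nat.one_le_two_pow
  rw [Nat.size_le, pow_succ, pow_add]
  nlinarith

theorem size_mul_le (a b : ℕ) : (a * b).size ≤ a.size + b.size := by
  rw [Nat.size_le, pow_add]
  exact Nat.mul_lt_mul'' (Nat.lt_size_self a) (Nat.lt_size_self b)

theorem esize_add_le (a b : ℕ) : esize (a + b) ≤ esize a + esize b + 5 := by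
  have := size_add_le a b
  simp only [esize_nat]
  omega

theorem esize_mul_le (a b : ℕ) : esize (a * b) ≤ esize a + esize b := by
  have := size_mul_le a b
  simp only [esize_nat]
  omega

/-- Horner's scheme: `bits` starts with the least significant digit, so a right fold begins with the
most significant one. Each step enlarges the state by a bounded amount, unlike iterated doubling of
arbitrary terms. -/
theorem mul_eq_foldr (a b : ℕ) :
    a * b = a.bits.foldr (fun t s => Nat.bit false s + (bif t then b else 0)) 0 := by
  induction a using Nat.binaryRec' with
  | zero => simp
  | bit t n h ih =>
    rw [Nat.bits_append_bit _ _ h, List.foldr_cons, ← ih]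
    cases t <;> simp [Nat.bit_val] <;> ring

@[fun_prop]
protected theorem PT.mul {f g : α → ℕ} (hf : PT f) (hg : PT g) : PT fun x => f x * g x := by
  have hgs := (hg.comp PT.fst (α := α × Bool)).polyB_esize
  refine (PT.foldr_add (F := fun x t s => Nat.bit false s + (bif t then g x else 0))
    (init := fun _ => 0) (l := fun x => (f x).bits) (g := fun p => esize (g p.1) + 20)
    (by fun_prop) (by fun_prop) (by fun_prop) (hgs.add (.const 20))
    fun x t s => ?_).congr fun x => mul_eq_foldr _ _
  refine (esize_add_le _ _).trans ?_
  have h1 := esize_bit_le false s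
  change _ ≤ esize s + (esize (g x) + 20)
  have h2 : esize (bif t then g x else 0) ≤ esize (g x) :=
    esize_nat_mono (by cases t <;> simp)
  omega

/-- One step of long division by `d`, with the quotient and the remainder so far. -/
def divStep (d : ℕ) (t : Bool) (s : ℕ × ℕ) : ℕ × ℕ :=
  bif Nat.ble d (Nat.bit t s.2) then (Nat.bit true s.1, Nat.bit t s.2 - d)
  else (Nat.bit false s.1, Nat.bit t s.2)

/-- The remainder stays below d, so after appending a digit it is below 2d and one conditional
subtraction suffices. -/
theorem foldr_divStep (a d : ℕ) (hd : 0 < d) :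
    a.bits.foldr (divStep d) (0, 0) = (a / d, a % d) := by
  induction a using Nat.binaryRec' with
  | zero => simp
  | bit t n h ih =>
    rw [Nat.bits_append_bit _ _ h, List.foldr_cons, ih]
    have h1 := Nat.div_add_mod n d
    have h2 := Nat.mod_lt n hd
    have h3 : t.toNat ≤ 1 := t.toNat_le
    unfold divStep
    by_cases hle : d ≤ Nat.bit t (n % d)
    · rw [Nat.ble_eq_true_of_le hle, cond_true, Prod.mk.injEq, eq_comm, eq_comm (a := _ - _),
        Nat.div_mod_unique hd]
      simp only [Nat.bit_val, Bool.toNat_true] at *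
      refine ⟨?_, by omega⟩
      rw [Nat.mul_add, mul_one, mul_left_comm d 2]
      omega
    · rw [Bool.eq_false_of_not_eq_true (fun h => hle (Nat.le_of_ble_eq_true h)), cond_false,
        Prod.mk.injEq, eq_comm, eq_comm (a := Nat.bit _ (_ % _)), Nat.div_mod_unique hd]
      simp only [Nat.bit_val, Bool.toNat_false] at *
      refine ⟨?_, by omega⟩
      rw [Nat.mul_add, mul_left_comm d 2]
      omega

@[fun_prop]
protected theorem PT.div {f g : α → ℕ} (hf : PT f) (hg : PT g) : PT fun x => f x / g x := by
  have h : PT fun x => (f x).bits.foldr (divStep (g x)) (0, 0) := by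
    refine PT.foldr_add (F := fun x => divStep (g x)) (init := fun _ => ((0, 0) : ℕ × ℕ))
      (l := fun x => (f x).bits) (g := fun _ => 12) (by unfold divStep; fun_prop) (.const _)
      (by fun_prop) (.const 12) fun x t s => ?_
    obtain ⟨q, r⟩ := s
    have h1 := esize_bit_le true q
    have h2 := esize_bit_le false q
    have h3 := esize_bit_le t r
    have h4 : esize (Nat.bit t r - g x) ≤ esize (Nat.bit t r) := esize_nat_mono (Nat.sub_le _ _)
    unfold divStep
    cases Nat.ble (g x) (Nat.bit t (q, r).2) <;> simp only [cond_true, cond_false, esize_pair] <;>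
      omega
  -- Division by 0 yields 0 by convention, while the long division would produce digits 1.
  have h' : PT fun x => bif g x == 0 then 0 else
      ((f x).bits.foldr (divStep (g x)) (0, 0)).1 := by fun_prop
  refine h'.congr fun x => ?_
  rcases Nat.eq_zero_or_pos (g x) with h | h
  · simp [h]
  · rw [foldr_divStep _ _ h, beq_false_of_ne h.ne', cond_false]

@[fun_prop]
protected theorem PT.mod {f g : α → ℕ} (hf : PT f) (hg : PT g) : PT fun x => f x % g x := by
  have h : PT fun x => f x - g x * (f x / g x) := by fun_prop
  exact h.congr fun x => by have := Nat.div_add_mod (f x) (g x); omega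

/-! Lists -/

theorem esize_drop_le (n : ℕ) (l : List α) : esize (l.drop n) ≤ esize l := by
  have h := esize_append (l.take n) (l.drop n)
  have := esize_pos (l.take n)
  rw [List.take_append_drop] at h
  omega

theorem esize_tail_le (l : List α) : esize l.tail ≤ esize l := by
  rw [← List.drop_one]; exact esize_drop_le 1 l

-- The number n is written in binary and may be exponentially larger than the list. A list at least
-- as long as `l` therefore serves as the clock, instead of n.
omit [Enc α] in
theorem drop_eq_foldl (c l : List α) (n : ℕ) (h : l.length ≤ c.length) :
    l.drop n = (c.foldl (fun s _ => bif s.1 == 0 then s else (s.1 - 1, s.2.tail)) (n, l)).2 := by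
  induction c generalizing l n with
  | nil =>
    have : l = [] := by simpa using h
    simp [this]
  | cons a c ih =>
    rw [List.foldl_cons]
    cases n with
    | zero =>
      have : ∀ (c : List α), c.foldl
          (fun s _ => bif s.1 == 0 then s else (s.1 - 1, s.2.tail)) (0, l) = (0, l) := by
        intro c; induction c with
        | nil => rfl
        | cons a c ih => simpa using ih
      simp [this]
    | succ n =>
      simp only [Nat.add_one_sub_one]
      rw [show ((n + 1 == 0) = false) from rfl, cond_false, ← ih _ _ (by simp at h ⊢; omega)]
      simp

@[fun_prop]
protected theorem PT.drop {f : α → ℕ} {g : α → List β} (hf : PT f) (hg : PT g) :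
    PT fun x => (g x).drop (f x) := by
  have h : PT fun x => (g x).foldl
      (fun s _ => bif s.1 == 0 then s else (s.1 - 1, s.2.tail)) (f x, g x) := by
    refine PT.foldl_add (F := fun _ (s : ℕ × List β) (_ : β) => bif s.1 == 0 then s else (s.1 - 1, s.2.tail))
      (g := fun _ => 0) (by fun_prop) (by fun_prop) hg (.const 0) fun x s a => ?_
    obtain ⟨n, l⟩ := s
    have h1 := esize_tail_le l
    have h2 : esize (n - 1) ≤ esize n := esize_nat_mono (Nat.sub_le _ _)
    cases h : (n, l).1 == 0 <;> simp only [cond_true, cond_false, esize_pair] <;> omega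
  exact (PT.snd.comp h).congr fun x => drop_eq_foldl _ _ _ le_rfl

@[fun_prop]
protected theorem PT.take {f : α → ℕ} {g : α → List β} (hf : PT f) (hg : PT g) :
    PT fun x => (g x).take (f x) := by
  have h : PT fun x => ((g x).drop (f x)).foldl (fun s _ => s.tail) (g x).reverse :=
    PT.foldl_add (F := fun _ (s : List β) (_ : β) => s.tail) (g := fun _ => 0) (by fun_prop)
      (by fun_prop) (by fun_prop) (.const 0) fun x s a => esize_tail_le s
  have key : ∀ c l : List β, c.foldl (fun s _ => s.tail) l = l.drop c.length := by
    intro c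
    induction c with
    | nil => intro l; rfl
    | cons a c ih => intro l; simp [ih]
  exact h.reverse.congr fun x => by
    rw [key, List.length_drop, List.drop_reverse, List.reverse_reverse]
    rcases le_total (f x) (g x).length with h | h
    · rw [Nat.sub_sub_self h]
    · rw [Nat.sub_eq_zero_of_le h, Nat.sub_zero, List.take_length, List.take_of_length_le h]

@[fun_prop]
protected theorem PT.getD {f : α → List β} {g : α → ℕ} (hf : PT f) (hg : PT g) (d : β) :
    PT fun x => (f x).getD (g x) d := by
  have h : PT fun x => ((f x).drop (g x)).headD d := by fun_prop
  exact h.congr fun x => by simp [List.getD_eq_getElem?_getD, List.headD_eq_head?_getD]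

theorem esize_le_length_mul (l : List α) (B : ℕ) (h : ∀ a ∈ l, esize a ≤ B) :
    esize l ≤ l.length * (B + 1) + 1 := by
  induction l with
  | nil => simp
  | cons a l ih =>
    have h1 := ih fun b hb => h b (by simp [hb])
    have h2 := h a (by simp)
    simp only [esize_cons, List.length_cons]
    nlinarith

theorem esize_nat_le (n : ℕ) : esize n ≤ 6 * n + 1 := by
  have : n.size ≤ n := Nat.size_le.2 Nat.lt_two_pow_self
  rw [esize_nat]
  omega

-- Lengths of lists play the role of unary numbers. Ranges, products, factorials and powers are only
-- formed up to the length of a list, since for a number in binary the result could be exponentially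
-- long.
@[fun_prop]
protected theorem PT.range_length {l : α → List β} (hl : PT l) : PT fun x => List.range (l x).length := by
  have hls := hl.polyB_esize
  have key : ∀ l : List β, l.foldl (fun s _ => (s.1 + 1, s.1 :: s.2)) (0, []) =
      (l.length, (List.range l.length).reverse) := by
    intro l
    induction l using List.reverseRecOn with
    | nil => rfl
    | append_singleton l a ih =>
      rw [List.foldl_append, ih, List.length_append, List.length_singleton, List.range_succ]
      simp
  have h : PT fun x => (l x).foldl (fun s _ => (s.1 + 1, s.1 :: s.2)) (0, []) := by
    refine PT.foldl (F := fun _ (s : ℕ × List ℕ) (_ : β) => (s.1 + 1, s.1 :: s.2))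
      (B := fun x => (6 * esize (l x) + 1) + (esize (l x) * ((6 * esize (l x) + 1) + 1) + 1) + 1)
      (by fun_prop) (.const _) hl (.add (.add (.add (.mul (.const 6) hls) (.const 1))
        (.add (.mul hls (.add (.add (.mul (.const 6) hls) (.const 1)) (.const 1))) (.const 1)))
        (.const 1)) fun x l₁ l₂ h => ?_
    have h1 : l₁.length ≤ esize (l x) := by
      have := length_lt_esize (l x)
      simp only [h, List.length_append] at *
      omega
    have h2 := esize_nat_le l₁.length
    have h3 := esize_le_length_mul (List.range l₁.length).reverse (6 * esize (l x) + 1) (by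
      intro a ha
      have h4 := esize_nat_le a
      simp at ha
      omega)
    have h5 : (List.range l₁.length).reverse.length ≤ esize (l x) := by simpa using h1
    have h6 := Nat.mul_le_mul_right (6 * esize (l x) + 1 + 1) h5
    rw [key, esize_pair]
    omega
  have h' : PT fun x => ((l x).foldl (fun s _ => (s.1 + 1, s.1 :: s.2))
    ((0, []) : ℕ × List ℕ)).2.reverse := by fun_prop
  exact h'.congr fun x => by rw [key, List.reverse_reverse]

protected theorem PT.prod_range {l : α → List β} {h : α → ℕ → ℕ} (hl : PT l)
    (hh : PT fun p : α × ℕ => h p.1 p.2) :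
    PT fun x => ∏ j ∈ Finset.range (l x).length, h x j := by
  have hF : PT fun p : (α × ℕ) × ℕ => p.1.2 * h p.1.1 p.2 :=
    (PT.snd.comp .fst).mul (hh.comp (f := fun p : (α × ℕ) × ℕ => (p.1.1, p.2)) (by fun_prop))
  refine (PT.foldl_add (F := fun x s j => s * h x j) (g := fun p => esize (h p.1 p.2))
    hF (.const 1) hl.range_length hh.polyB_esize fun x s a => esize_mul_le _ _).congr fun x => ?_
  induction (l x).length with
  | zero => simp
  | succ n ih => rw [Finset.prod_range_succ, List.range_succ, List.foldl_append, ih]; rfl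

protected theorem PT.sum_range {l : α → List β} {h : α → ℕ → ℕ} (hl : PT l)
    (hh : PT fun p : α × ℕ => h p.1 p.2) :
    PT fun x => ∑ j ∈ Finset.range (l x).length, h x j := by
  have hF : PT fun p : (α × ℕ) × ℕ => p.1.2 + h p.1.1 p.2 :=
    (PT.snd.comp .fst).add (hh.comp (f := fun p : (α × ℕ) × ℕ => (p.1.1, p.2)) (by fun_prop))
  refine (PT.foldl_add (F := fun x s j => s + h x j) (g := fun p => esize (h p.1 p.2) + 5)
    hF (.const 0) hl.range_length (hh.polyB_esize.add (.const 5))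
    fun x s a => esize_add_le _ _).congr fun x => ?_
  induction (l x).length with
  | zero => simp
  | succ n ih => rw [Finset.sum_range_succ, List.range_succ, List.foldl_append, ih]; rfl

@[fun_prop]
protected theorem PT.factorial_length {l : α → List β} (hl : PT l) : PT fun x => (l x).length.factorial :=
  (PT.prod_range (h := fun _ j => j + 1) hl (by fun_prop)).congr
    fun _ => (Finset.prod_range_add_one_eq_factorial _).symm

@[fun_prop]
protected theorem PT.pow_length {f : α → ℕ} {l : α → List β} (hf : PT f) (hl : PT l) :
    PT fun x => f x ^ (l x).length :=
  (PT.prod_range (h := fun x _ => f x) hl (by fun_prop)).congr fun x => by simp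

end

/-! ### The algorithm -/

/-- The domain sizes, the point `v`, the feature `i` and the weights `(a, b)` of the other features
and of the feature `i`: the value `y` of feature `j` has the weight `a + b * D j * [y = v j]`. -/
abbrev Params : Type := (List ℕ × List ℕ) × (ℕ × ((ℕ × ℕ) × (ℕ × ℕ)))

/-- The constant part of the weights of feature `j`. -/
def coefA (p : Params) (j : ℕ) : ℕ := bif Nat.beq j p.2.1 then p.2.2.2.1 else p.2.2.1.1

/-- The part of the weights of feature `j` that depends on the value. -/
def coefB (p : Params) (j : ℕ) : ℕ := bif Nat.beq j p.2.1 then p.2.2.2.2 else p.2.2.1.2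

/-- The sum of the weights of the values of feature `j`. -/
def featureWeight (p : Params) (j : ℕ) : ℕ := p.1.1.getD j 0 * (coefA p j + coefB p j)

/-- The sum of the weights of all points. -/
def totalWeight (p : Params) : ℕ := ∏ j ∈ Finset.range p.1.1.length, featureWeight p j

/-- The weight of the value `a` of feature `j`. -/
def valueWeight (p : Params) (j a : ℕ) : ℕ :=
  coefA p j + bif Nat.beq a (p.1.2.getD j 0) then coefB p j * p.1.1.getD j 0 else 0

/-- The sum of the weights of the points where the first of the encoded gates `s.1` is true, given
these sums for the preceding gates and the total weight `T`. -/
def gateWeight (c : Params × ℕ) (s : List ℕ × List ℕ) : ℕ :=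
  bif s.1.headD 0 == 0 then (bif s.1.getD 1 0 == 0 then 0 else c.2)
  else bif Nat.beq (s.1.headD 0) 1 then
    -- The quotient is the total weight of the assignments to the other features.
    valueWeight c.1 (s.1.getD 1 0) (s.1.getD 2 0) * (c.2 / featureWeight c.1 (s.1.getD 1 0))
  else bif Nat.beq (s.1.headD 0) 2 then c.2 - s.2.getD (s.1.getD 1 0) 0
  else bif Nat.beq (s.1.headD 0) 3 then
    -- The minimum with the total weight changes nothing for genuine circuits, but bounds the state
    -- on every input word, also on those that encode no instance.
    ((s.1.drop 2).take (s.1.getD 1 0)).foldl (fun x g => min c.2 (x * s.2.getD g 0 / c.2)) c.2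
  else ((s.1.drop 2).take (s.1.getD 1 0)).foldl (fun x g => min c.2 (x + s.2.getD g 0)) 0

/-- Remove the first encoded gate. -/
def dropGate (l : List ℕ) : List ℕ :=
  bif Nat.beq (l.headD 0) 1 then l.drop 3
  else bif Nat.ble (l.headD 0) 2 then l.drop 2
  else (l.drop 2).drop (l.getD 1 0)

/-- Process the first of the remaining gates. -/
def gateStep (c : Params × ℕ) (s : List ℕ × List ℕ) : List ℕ × List ℕ :=
  bif s.1.isEmpty then s else (dropGate s.1, s.2 ++ [min c.2 (gateWeight c s)])

/-- The weights of the sets of points where the gates are true. -/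
def gateWeights (p : Params) (gates : List ℕ) : List ℕ :=
  -- The list of numbers is a clock with at least one tick per gate; superfluous ticks have no
  -- effect.
  (gates.foldl (fun s _ => gateStep (p, totalWeight p) s) (gates, [])).2

/-- The weight of the set of points where gate `n` has the same value as at `v`. -/
def simWeight (x : (List ℕ × List ℕ) × (ℕ × (ℕ × List ℕ))) (w : (ℕ × ℕ) × (ℕ × ℕ)) : ℕ :=
  -- The weights (0, 1) for all features are concentrated at v, so this entry vanishes exactly if
  -- gate `n` is false at v.
  bif (gateWeights (x.1, (x.2.1, ((0, 1), (0, 1)))) x.2.2.2).getD x.2.2.1 0 == 0 then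
    totalWeight (x.1, (x.2.1, w)) - (gateWeights (x.1, (x.2.1, w)) x.2.2.2).getD x.2.2.1 0
  else (gateWeights (x.1, (x.2.1, w)) x.2.2.2).getD x.2.2.1 0

/-- The sum of the digits of `N` in base `Z`, weighted with Shapley coefficients. -/
def weightedDigits (D : List ℕ) (Z N : ℕ) : ℕ :=
  -- For l < m the lists `D.take l` and `D.drop (l + 1)` have the lengths l and m - l - 1. They
  -- supply the exponent and the arguments of the factorials in unary.
  ∑ l ∈ Finset.range D.length, (D.take l).length.factorial * (D.drop (l + 1)).length.factorial *
    (N / Z ^ (D.take l).length % Z)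

/-- A base that exceeds all digits. -/
def digitBase (D : List ℕ) : ℕ := ∏ j ∈ Finset.range D.length, 2 * D.getD j 0 + 1

/-- Read an instance. -/
def parse (l : List ℕ) : (List ℕ × List ℕ) × (ℕ × (ℕ × List ℕ)) :=
  ((l.tail.take (l.headD 0), (l.tail.drop (l.headD 0)).take (l.headD 0)),
    (((l.tail.drop (l.headD 0)).drop (l.headD 0)).headD 0,
      (((l.tail.drop (l.headD 0)).drop (l.headD 0)).tail.headD 0,
        ((l.tail.drop (l.headD 0)).drop (l.headD 0)).tail.tail)))

/-- The positive and the negative part of the numerator of the score. -/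
def numerators (x : (List ℕ × List ℕ) × (ℕ × (ℕ × List ℕ))) : ℕ × ℕ :=
  -- For feature i the weights (0, 1) force i into the set on which x agrees with v; (1, 0) in the
  -- next line keeps it out.
  (weightedDigits x.1.1 (digitBase x.1.1) (simWeight x ((1, digitBase x.1.1), (0, 1))),
    weightedDigits x.1.1 (digitBase x.1.1) (simWeight x ((1, digitBase x.1.1), (1, 0))))

/-- The denominator of the score. -/
def denominator (D : List ℕ) : ℕ := D.length.factorial * ∏ j ∈ Finset.range D.length, D.getD j 0

/-- The score, as the sign and the absolute value of the numerator and the denominator. -/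
def scoreNats (x : (List ℕ × List ℕ) × (ℕ × (ℕ × List ℕ))) : List ℕ :=
  [bif Nat.ble (numerators x).2 (numerators x).1 then 0 else 1,
    -- One of the two truncated differences is 0, the other is the absolute value.
    ((numerators x).1 - (numerators x).2) + ((numerators x).2 - (numerators x).1),
    denominator x.1.1]

/-- Read a list of numbers. -/
def decodeNats (s : List Sym) : List ℕ :=
  s.foldr (fun o l => bif o.isNone then 0 :: l
    else Nat.bit (o.getD false) (l.headD 0) :: l.tail) []

theorem decodeNats_encodeNats (l : List ℕ) : decodeNats (encodeNats l) = l := by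
  have key : ∀ (n : ℕ) (l : List ℕ), (n.bits.map some ++ [none]).foldr
      (fun (o : Sym) l => bif o.isNone then 0 :: l
        else Nat.bit (o.getD false) (l.headD 0) :: l.tail) l = n :: l := by
    intro n l
    induction n using Nat.binaryRec' with
    | zero => simp
    | bit b n h ih =>
      rw [Nat.bits_append_bit _ _ h, List.map_cons, List.cons_append, List.foldr_cons, ih]
      simp
  induction l with
  | nil => rfl
  | cons n l ih =>
    unfold decodeNats encodeNats at *
    rw [List.flatMap_cons, List.foldr_append, ih, key]

/-! ### The algorithm runs in polynomial time -/

section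

variable {α β γ σ : Type} [Enc α] [Enc β] [Enc γ] [Enc σ]

@[fun_prop]
protected theorem PT.symPair {f : α → Sym} (hf : PT f) : PT fun x => ((f x).isNone, (f x).getD false) :=
  hf.congr_enc fun _ => rfl

@[fun_prop]
protected theorem PT.some {f : α → Bool} (hf : PT f) : PT fun x => (some (f x) : Sym) :=
  ((PT.const false).prodMk hf).congr_enc fun _ => rfl

@[fun_prop]
protected theorem PT.isNone {f : α → Sym} (hf : PT f) : PT fun x => (f x).isNone :=
  PT.fst.comp hf.symPair

@[fun_prop]
protected theorem PT.symGetD {f : α → Sym} (hf : PT f) : PT fun x => (f x).getD false :=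
  PT.snd.comp hf.symPair

protected theorem PT.decodeNats : PT decodeNats := by
  refine PT.foldr_add (F := fun _ (o : Sym) (l : List ℕ) => bif o.isNone then 0 :: l
    else Nat.bit (o.getD false) (l.headD 0) :: l.tail) (l := fun s => s) (g := fun _ => 10)
    (by fun_prop) (.const _) (by fun_prop) (.const 10) fun x o l => ?_
  have h : esize (0 : ℕ) = 1 := rfl
  have h2 := esize_bit_le (o.getD false) (l.headD 0)
  cases o.isNone <;> cases l <;>
    simp only [cond_true, cond_false, esize_cons, List.headD_cons, List.headD_nil, List.tail_cons,
      List.tail_nil, esize_nil] at * <;> omega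

protected theorem PT.encodeNats {f : α → List ℕ} (hf : PT f) : PT fun x => encodeNats (f x) := by
  have h1 : PT fun n : ℕ => n.bits.map Option.some ++ [none] := by
    refine (PT.foldr_add (F := fun _ (b : Bool) (s : List Sym) => Option.some b :: s)
      (init := fun _ => [none]) (l := fun n : ℕ => n.bits) (g := fun _ => 12) (by fun_prop)
      (.const _) (by fun_prop) (.const 12) fun x b s => ?_).congr fun n => ?_
    · simp only [esize_cons, esize_sym]; omega
    · induction n.bits with
      | nil => rfl
      | cons b l ih => simp [← ih]
  refine (PT.foldr_add (F := fun _ (n : ℕ) (s : List Sym) => (n.bits.map Option.some ++ [none]) ++ s)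
    (init := fun _ => []) (l := f)
    (g := fun p => esize ((fun n : ℕ => n.bits.map Option.some ++ [none]) p.2)) ?_
    (.const _) hf.reverse (h1.comp PT.snd).polyB_esize fun x n s => ?_).congr fun x => ?_
  · exact (h1.comp PT.snd).append (by fun_prop)
  · have := esize_append (n.bits.map Option.some ++ [none]) s
    simp only
    omega
  · unfold SimShap.encodeNats
    induction f x with
    | nil => rfl
    | cons n l ih => rw [List.flatMap_cons, ih]; rfl

@[fun_prop]
protected theorem PT.coefA {f : α → Params} {g : α → ℕ} (hf : PT f) (hg : PT g) :
    PT fun x => coefA (f x) (g x) := by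
  unfold SimShap.coefA; fun_prop

@[fun_prop]
protected theorem PT.coefB {f : α → Params} {g : α → ℕ} (hf : PT f) (hg : PT g) :
    PT fun x => coefB (f x) (g x) := by
  unfold SimShap.coefB; fun_prop

@[fun_prop]
protected theorem PT.featureWeight {f : α → Params} {g : α → ℕ} (hf : PT f) (hg : PT g) :
    PT fun x => featureWeight (f x) (g x) := by
  unfold SimShap.featureWeight; fun_prop

@[fun_prop]
protected theorem PT.totalWeight {f : α → Params} (hf : PT f) : PT fun x => totalWeight (f x) :=
  PT.prod_range (l := fun x => (f x).1.1) (by fun_prop) (by fun_prop)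

@[fun_prop]
protected theorem PT.valueWeight {f : α → Params} {g h : α → ℕ} (hf : PT f) (hg : PT g) (hh : PT h) :
    PT fun x => valueWeight (f x) (g x) (h x) := by
  unfold SimShap.valueWeight; fun_prop

/-- Clamping bounds every state by the size of `T`, whatever `h` computes. In particular the
repeated products in AND gates cannot grow. -/
protected theorem PT.foldl_min {l : α → List β} {init T : α → ℕ} {h : (α × ℕ) × β → ℕ} (hl : PT l)
    (hi : PT init) (hT : PT T) (hh : PT h) :
    PT fun x => (l x).foldl (fun s a => min (T x) (h ((x, s), a))) (init x) := by
  refine PT.foldl_add (F := fun x s a => min (T x) (h ((x, s), a))) (g := fun p => esize (T p.1))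
    (PT.min (by fun_prop) hh) hi hl (hT.comp PT.fst).polyB_esize fun x s a => ?_
  exact (esize_nat_mono (min_le_left _ _)).trans (Nat.le_add_left _ _)

protected theorem PT.gateWeight : PT fun p : (Params × ℕ) × (List ℕ × List ℕ) => gateWeight p.1 p.2 := by
  have h1 : PT fun p : (Params × ℕ) × (List ℕ × List ℕ) =>
      ((p.2.1.drop 2).take (p.2.1.getD 1 0)).foldl
        (fun x g => min p.1.2 (x * p.2.2.getD g 0 / p.1.2)) p.1.2 :=
    PT.foldl_min (l := fun p : (Params × ℕ) × (List ℕ × List ℕ) =>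
      (p.2.1.drop 2).take (p.2.1.getD 1 0)) (init := fun p => p.1.2) (T := fun p => p.1.2)
      (h := fun q => q.1.2 * q.1.1.2.2.getD q.2 0 / q.1.1.1.2) (by fun_prop) (by fun_prop)
      (by fun_prop) (by fun_prop)
  have h2 : PT fun p : (Params × ℕ) × (List ℕ × List ℕ) =>
      ((p.2.1.drop 2).take (p.2.1.getD 1 0)).foldl
        (fun x g => min p.1.2 (x + p.2.2.getD g 0)) 0 :=
    PT.foldl_min (l := fun p : (Params × ℕ) × (List ℕ × List ℕ) =>
      (p.2.1.drop 2).take (p.2.1.getD 1 0)) (init := fun _ => 0) (T := fun p => p.1.2)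
      (h := fun q => q.1.2 + q.1.1.2.2.getD q.2 0) (by fun_prop) (by fun_prop)
      (by fun_prop) (by fun_prop)
  unfold SimShap.gateWeight
  fun_prop

@[fun_prop]
protected theorem PT.dropGate {f : α → List ℕ} (hf : PT f) : PT fun x => dropGate (f x) := by
  unfold SimShap.dropGate; fun_prop

protected theorem PT.gateStep : PT fun p : (Params × ℕ) × (List ℕ × List ℕ) => gateStep p.1 p.2 := by
  have := PT.gateWeight
  unfold SimShap.gateStep; fun_prop

theorem esize_gateStep_le (c : Params × ℕ) (s : List ℕ × List ℕ) :
    esize (gateStep c s) ≤ esize s + (esize c.2 + 2) := by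
  obtain ⟨r, l⟩ := s
  have h1 : esize (dropGate r) ≤ esize r := by
    unfold dropGate
    cases Nat.beq (r.headD 0) 1 <;> cases Nat.ble (r.headD 0) 2 <;>
      simp only [cond_true, cond_false, List.drop_drop] <;> exact esize_drop_le _ _
  have h2 : esize (min c.2 (gateWeight c (r, l))) ≤ esize c.2 := esize_nat_mono (min_le_left _ _)
  have h3 := esize_append l [min c.2 (gateWeight c (r, l))]
  unfold gateStep
  cases (r, l).1.isEmpty <;> simp only [cond_true, cond_false, esize_pair, esize_cons, esize_nil] at *
    <;> omega

@[fun_prop]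
protected theorem PT.gateWeights {f : α → Params} {g : α → List ℕ} (hf : PT f) (hg : PT g) :
    PT fun x => gateWeights (f x) (g x) := by
  have hT : PT fun x : α × ℕ => SimShap.totalWeight (f x.1) := by fun_prop
  have h : PT fun x => (g x).foldl
      (fun s _ => SimShap.gateStep (f x, SimShap.totalWeight (f x)) s) (g x, []) := by
    refine PT.foldl_add (F := fun x s (_ : ℕ) => SimShap.gateStep (f x, SimShap.totalWeight (f x)) s)
      (init := fun x => (g x, [])) (g := fun p => esize (SimShap.totalWeight (f p.1)) + 2) ?_
      (by fun_prop) hg (hT.polyB_esize.add (.const 2)) fun x s a => esize_gateStep_le _ _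
    exact PT.gateStep.comp (f := fun p : (α × (List ℕ × List ℕ)) × ℕ =>
      ((f p.1.1, SimShap.totalWeight (f p.1.1)), p.1.2)) (by fun_prop)
  exact PT.snd.comp h

@[fun_prop]
protected theorem PT.simWeight {f : α → (List ℕ × List ℕ) × (ℕ × (ℕ × List ℕ))}
    {g : α → (ℕ × ℕ) × (ℕ × ℕ)} (hf : PT f) (hg : PT g) :
    PT fun x => simWeight (f x) (g x) := by
  unfold SimShap.simWeight; fun_prop

@[fun_prop]
protected theorem PT.weightedDigits {f : α → List ℕ} {g h : α → ℕ} (hf : PT f) (hg : PT g) (hh : PT h) :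
    PT fun x => weightedDigits (f x) (g x) (h x) := by
  unfold SimShap.weightedDigits
  exact PT.sum_range hf (by fun_prop)

@[fun_prop]
protected theorem PT.digitBase {f : α → List ℕ} (hf : PT f) : PT fun x => digitBase (f x) := by
  have h : PT fun x => ∏ j ∈ Finset.range (f x).length, 2 * (f x).getD j 0 :=
    PT.prod_range hf (by fun_prop)
  unfold SimShap.digitBase; fun_prop

@[fun_prop]
protected theorem PT.denominator {f : α → List ℕ} (hf : PT f) : PT fun x => denominator (f x) := by
  have h : PT fun x => ∏ j ∈ Finset.range (f x).length, (f x).getD j 0 :=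
    PT.prod_range hf (by fun_prop)
  unfold SimShap.denominator; fun_prop

@[fun_prop]
protected theorem PT.parse {f : α → List ℕ} (hf : PT f) : PT fun x => parse (f x) := by
  unfold SimShap.parse; fun_prop

protected theorem PT.scoreNats : PT scoreNats := by
  have h : PT numerators := by
    unfold SimShap.numerators; fun_prop
  unfold SimShap.scoreNats; fun_prop

end

/-- The algorithm, on words. -/
def scoreWord (s : List Sym) : List Sym := encodeNats (scoreNats (parse (decodeNats s)))

protected theorem PT.scoreWord : PT scoreWord := .encodeNats (PT.scoreNats.comp (.parse .decodeNats))

/-! ### Weighted counting -/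

section

variable {m : ℕ} {D : Fin m → ℕ}

/-- The points that agree with v on S are free exactly outside S. This gives all values of the
characteristic function the common denominator ∏ D_j. -/
theorem prod_mul_card_consistent (v : Point D) (S : Finset (Fin m)) :
    (∏ j ∈ S, D j) * (consistent v S).card = ∏ j, D j := by
  have h : consistent v S =
      Fintype.piFinset fun j => if j ∈ S then ({v j} : Finset (Fin (D j))) else Finset.univ := by
    ext x
    simp only [consistent, Finset.mem_filter, Finset.mem_univ, true_and, Fintype.mem_piFinset]
    refine forall_congr' fun j => ?_
    by_cases hj : j ∈ S <;> simp [hj]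
  rw [h, Fintype.card_piFinset, ← Finset.prod_mul_prod_compl S D]
  congr 1
  rw [← Finset.prod_mul_prod_compl S, Finset.prod_eq_one fun j hj => by simp [hj], one_mul]
  exact Finset.prod_congr rfl fun j hj => by simp [Finset.mem_compl.1 hj]

/-- The number of points that satisfy `σ` and agree with `v` on `S`, times the number of
assignments of values to `S`. -/
def scaledCount (σ : Point D → Bool) (v : Point D) (S : Finset (Fin m)) : ℕ :=
  (∏ j ∈ S, D j) * ((consistent v S).filter fun x => σ x = true).card

theorem scaledCount_le (σ : Point D → Bool) (v : Point D) (S : Finset (Fin m)) :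
    scaledCount σ v S ≤ ∏ j, D j := by
  rw [← prod_mul_card_consistent v S]
  exact Nat.mul_le_mul_left _ (Finset.card_filter_le _ _)

/-- The weight of a point. -/
def pointWeight (a b : Fin m → ℕ) (v x : Point D) : ℕ :=
  ∏ j, (a j + if x j = v j then b j * D j else 0)

/-- The weight of a set of points. -/
def weight (a b : Fin m → ℕ) (v : Point D) (σ : Point D → Bool) : ℕ :=
  ∑ x, if σ x = true then pointWeight a b v x else 0

/-- Expanding ∏ (1 + Z D_j [x_j = v_j]) over the subsets S of U leaves, for each S, the term Z ^ |S|
∏_{j ∈ S} D_j if x agrees with v on S. The factor over T forces agreement on T; summing over x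
counts points. -/
theorem sum_pow_mul_scaledCount (σ : Point D → Bool) (v : Point D) (U : Finset (Fin m)) (Z : ℕ)
    (T : Finset (Fin m)) (hT : Disjoint U T) :
    (∑ x, if σ x = true then (∏ j ∈ T, if x j = v j then D j else 0) *
      ∏ j ∈ U, (1 + if x j = v j then Z * D j else 0) else 0) =
      ∑ S ∈ U.powerset, Z ^ S.card * scaledCount σ v (S ∪ T) := by
  have h1 : ∀ x : Point D, (if σ x = true then (∏ j ∈ T, if x j = v j then D j else 0) *
      ∏ j ∈ U, (1 + if x j = v j then Z * D j else 0) else 0) =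
      ∑ S ∈ U.powerset, Z ^ S.card * ((∏ j ∈ S ∪ T, D j) *
        if (∀ j ∈ S ∪ T, x j = v j) ∧ σ x = true then 1 else 0) := by
    intro x
    split_ifs with hx
    · rw [Finset.prod_one_add, Finset.mul_sum]
      refine Finset.sum_congr rfl fun S hS => ?_
      rw [Finset.prod_ite_zero, Finset.prod_ite_zero, Finset.prod_mul_distrib,
        Finset.prod_const, Finset.prod_union (hT.mono_left (Finset.mem_powerset.1 hS))]
      by_cases hS1 : ∀ j ∈ S, x j = v j <;> by_cases hT1 : ∀ j ∈ T, x j = v j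
      · have : ∀ j ∈ S ∪ T, x j = v j := fun j hj => (Finset.mem_union.1 hj).elim (hS1 j) (hT1 j)
        rw [if_pos hS1, if_pos hT1, if_pos ⟨this, hx⟩]
        ring
      · have hn : ¬((∀ j ∈ S ∪ T, x j = v j) ∧ σ x = true) :=
          fun h => hT1 fun j hj => h.1 j (Finset.mem_union_right _ hj)
        rw [if_neg hT1, if_neg hn]
        simp
      · have hn : ¬((∀ j ∈ S ∪ T, x j = v j) ∧ σ x = true) :=
          fun h => hS1 fun j hj => h.1 j (Finset.mem_union_left _ hj)
        rw [if_neg hS1, if_neg hn]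
        simp
      · have hn : ¬((∀ j ∈ S ∪ T, x j = v j) ∧ σ x = true) :=
          fun h => hS1 fun j hj => h.1 j (Finset.mem_union_left _ hj)
        rw [if_neg hS1, if_neg hn]
        simp
    · simp [hx]
  rw [Finset.sum_congr rfl fun x _ => h1 x, Finset.sum_comm]
  refine Finset.sum_congr rfl fun S _ => ?_
  rw [← Finset.mul_sum, ← Finset.mul_sum, scaledCount, consistent, Finset.filter_filter,
    Finset.card_filter]

theorem weight_pos_part (σ : Point D → Bool) (v : Point D) (i : Fin m) (Z : ℕ) :
    weight (fun j => if j = i then 0 else 1) (fun j => if j = i then 1 else Z) v σ =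
      ∑ S ∈ (Finset.univ \ {i}).powerset, Z ^ S.card * scaledCount σ v (S ∪ {i}) := by
  rw [← sum_pow_mul_scaledCount σ v _ Z {i} Finset.sdiff_disjoint]
  refine Finset.sum_congr rfl fun x _ => ?_
  rw [pointWeight, ← Finset.prod_sdiff (Finset.subset_univ {i}), mul_comm]
  congr 2
  · simp
  · refine Finset.prod_congr rfl fun j hj => ?_
    have : j ≠ i := by simpa using hj
    simp [this]

theorem weight_neg_part (σ : Point D → Bool) (v : Point D) (i : Fin m) (Z : ℕ) :
    weight (fun _ => 1) (fun j => if j = i then 0 else Z) v σ =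
      ∑ S ∈ (Finset.univ \ {i}).powerset, Z ^ S.card * scaledCount σ v S := by
  have h := sum_pow_mul_scaledCount σ v (Finset.univ \ {i}) Z ∅ (Finset.disjoint_empty_right _)
  simp only [Finset.union_empty, Finset.prod_empty, one_mul] at h
  rw [← h]
  refine Finset.sum_congr rfl fun x _ => ?_
  rw [pointWeight, ← Finset.prod_sdiff (Finset.subset_univ {i})]
  congr 1
  rw [Finset.prod_singleton, if_pos rfl, zero_mul, ite_self, add_zero, mul_one]
  refine Finset.prod_congr rfl fun j hj => ?_
  have : j ≠ i := by simpa using hj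
  simp [this]

/-- Collecting terms with equal exponents gives the expansion in base Z: every coefficient is below
Z, so no carry occurs. Terms with smaller exponents add up to less than Z ^ l, and those with larger
exponents vanish modulo Z after the division. -/
theorem sum_pow_mul_digit {ι : Type} (A : Finset ι) (d c : ι → ℕ) (Z l : ℕ)
    (hZ : ∑ s ∈ A, c s < Z) :
    (∑ s ∈ A, Z ^ d s * c s) / Z ^ l % Z = ∑ s ∈ A with d s = l, c s := by
  have hZ0 : 0 < Z := by omega
  have hmid : ∑ s ∈ A with d s = l, c s < Z :=
    (Finset.sum_le_sum_of_subset (Finset.filter_subset _ _)).trans_lt hZ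
  have hlow : ∑ s ∈ A with d s < l, Z ^ d s * c s < Z ^ l := by
    cases l with
    | zero => simp
    | succ l =>
      calc ∑ s ∈ A with d s < l + 1, Z ^ d s * c s
          ≤ ∑ s ∈ A with d s < l + 1, Z ^ l * c s := by
            refine Finset.sum_le_sum fun s hs => Nat.mul_le_mul_right _
              (Nat.pow_le_pow_right hZ0 ?_)
            have := (Finset.mem_filter.1 hs).2
            omega
        _ = Z ^ l * ∑ s ∈ A with d s < l + 1, c s := by rw [Finset.mul_sum]
        _ ≤ Z ^ l * ∑ s ∈ A, c s :=
            Nat.mul_le_mul_left _ (Finset.sum_le_sum_of_subset (Finset.filter_subset _ _))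
        _ < Z ^ (l + 1) := by
            rw [pow_succ]
            exact Nat.mul_lt_mul_of_pos_left hZ (by positivity)
  have hsplit : ∑ s ∈ A, Z ^ d s * c s = ∑ s ∈ A with d s < l, Z ^ d s * c s +
      Z ^ l * (∑ s ∈ A with d s = l, c s + Z * ∑ s ∈ A with l < d s, Z ^ (d s - l - 1) * c s) := by
    rw [mul_add, ← mul_assoc, Finset.mul_sum, Finset.mul_sum, Finset.sum_filter, Finset.sum_filter,
      Finset.sum_filter, ← Finset.sum_add_distrib, ← Finset.sum_add_distrib]
    refine Finset.sum_congr rfl fun s _ => ?_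
    rcases lt_trichotomy (d s) l with h | h | h
    · simp [h, h.ne, h.not_gt]
    · simp [h]
    · simp only [h, h.ne', h.not_gt, if_true, if_false, zero_add]
      rw [← mul_assoc, ← pow_succ, ← pow_add]
      congr 2
      omega
  rw [hsplit, Nat.add_mul_div_left _ _ (by positivity), Nat.div_eq_of_lt hlow, zero_add,
    Nat.add_mul_mod_self_left, Nat.mod_eq_of_lt hmid]

/-- There are at most 2 ^ m sets S, and each count is at most ∏ D_j. The summand 1 stands outside
the product. -/
theorem sum_scaledCount_lt (σ : Point D → Bool) (v : Point D) (i : Fin m)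
    (f : Finset (Fin m) → Finset (Fin m)) :
    ∑ S ∈ (Finset.univ \ {i}).powerset, scaledCount σ v (f S) < ∏ j, (2 * D j) + 1 := by
  refine Nat.lt_succ_of_le ((Finset.sum_le_card_nsmul _ _ (∏ j, D j)
    fun S _ => scaledCount_le _ _ _).trans ?_)
  rw [smul_eq_mul, Finset.prod_mul_distrib, Finset.card_powerset, Finset.prod_const]
  exact Nat.mul_le_mul_right _ (Nat.pow_le_pow_right (by norm_num)
    (Finset.card_le_card (Finset.subset_univ _)))

theorem weightedDigits_eq (σ : Point D → Bool) (v : Point D) (i : Fin m)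
    (f : Finset (Fin m) → Finset (Fin m)) (L : List ℕ) (hL : L.length = m) (Z : ℕ)
    (hZ : Z = ∏ j, (2 * D j) + 1) :
    weightedDigits L Z
      (∑ S ∈ (Finset.univ \ {i}).powerset, Z ^ S.card * scaledCount σ v (f S)) =
      ∑ S ∈ (Finset.univ \ {i}).powerset, S.card.factorial * (m - S.card - 1).factorial *
        scaledCount σ v (f S) := by
  have hmaps : ∀ S ∈ (Finset.univ \ {i} : Finset (Fin m)).powerset,
      S.card ∈ Finset.range m := by
    intro S hS
    have h1 : S ⊂ Finset.univ := by
      refine Finset.ssubset_univ_iff.2 fun h => ?_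
      have := Finset.mem_powerset.1 hS (h ▸ Finset.mem_univ i)
      simp at this
    have := Finset.card_lt_card h1
    simpa using this
  rw [← Finset.sum_fiberwise_of_maps_to hmaps fun S =>
    S.card.factorial * (m - S.card - 1).factorial * scaledCount σ v (f S), weightedDigits, hL]
  refine Finset.sum_congr rfl fun l hl => ?_
  have hl' := Finset.mem_range.1 hl
  rw [List.length_take, List.length_drop, hL, min_eq_left hl'.le, sum_pow_mul_digit _ _ _ _ _
    (hZ ▸ sum_scaledCount_lt σ v i f), Finset.mul_sum]
  refine Finset.sum_congr rfl fun S hS => ?_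
  rw [(Finset.mem_filter.1 hS).2, Nat.sub_sub]

theorem shapley_simCharFun (κ : Point D → Bool) (v : Point D) (i : Fin m) :
    shapley (simCharFun κ v) i =
      ((∑ S ∈ (Finset.univ \ {i}).powerset, S.card.factorial * (m - S.card - 1).factorial *
          scaledCount (fun x => κ x == κ v) v (S ∪ {i}) : ℕ) -
        (∑ S ∈ (Finset.univ \ {i}).powerset, S.card.factorial * (m - S.card - 1).factorial *
          scaledCount (fun x => κ x == κ v) v S : ℕ)) /
        ((m.factorial * ∏ j, D j : ℕ) : ℝ) := by
  have hpos : ∀ j, 0 < D j := fun j => (v j).pos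
  have hP : ((∏ j, D j : ℕ) : ℝ) ≠ 0 := by
    exact_mod_cast (Finset.prod_pos fun j _ => hpos j).ne'
  have hν : ∀ S, simCharFun κ v S =
      (scaledCount (fun x => κ x == κ v) v S : ℝ) / ((∏ j, D j : ℕ) : ℝ) := by
    intro S
    have h1 := prod_mul_card_consistent v S
    have h2 : ((∏ j ∈ S, D j : ℕ) : ℝ) ≠ 0 := by
      exact_mod_cast (Finset.prod_pos fun j _ => hpos j).ne'
    have h3 : ((consistent v S).card : ℝ) ≠ 0 := by
      intro h
      rw [← h1, Nat.cast_mul, h, mul_zero] at hP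
      exact hP rfl
    have h4 : ∑ x ∈ consistent v S, similarity κ v x =
        (((consistent v S).filter fun x => (κ x == κ v) = true).card : ℝ) := by
      simp [similarity]
    rw [simCharFun, condExpect, h4, scaledCount, ← h1, Nat.cast_mul, Nat.cast_mul]
    field_simp
  have hm : (m.factorial : ℝ) ≠ 0 := by exact_mod_cast m.factorial_ne_zero
  rw [shapley, eq_div_iff (by push_cast at *; positivity)]
  rw [Nat.cast_sum, Nat.cast_sum, ← Finset.sum_sub_distrib, Finset.sum_mul]
  refine Finset.sum_congr rfl fun S _ => ?_
  rw [hν, hν, Nat.cast_mul _ (scaledCount _ _ _), Nat.cast_mul _ (scaledCount _ _ _),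
    Nat.cast_mul m.factorial]
  field_simp

end

/-! ### Weights of gates -/

section

variable {m : ℕ} {D : Fin m → ℕ} (a b : Fin m → ℕ) (v : Point D)

theorem sum_prod_eq_prod_sum (u : (j : Fin m) → Fin (D j) → ℕ) :
    ∑ x : Point D, ∏ j, u j (x j) = ∏ j, ∑ y, u j y :=
  (Fintype.prod_sum u).symm

theorem sum_value_weights (j : Fin m) :
    ∑ y, (a j + if y = v j then b j * D j else 0) = D j * (a j + b j) := by
  rw [Finset.sum_add_distrib, Finset.sum_const, Finset.sum_ite_eq']
  simp
  ring

theorem weight_true : weight a b v (fun _ => true) = ∏ j, D j * (a j + b j) := by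
  simp only [weight, if_true, pointWeight]
  rw [sum_prod_eq_prod_sum fun j y => a j + if y = v j then b j * D j else 0]
  exact Finset.prod_congr rfl fun j _ => sum_value_weights a b v j

theorem weight_false : weight a b v (fun _ => false) = 0 := by simp [weight]

theorem weight_not (g : Point D → Bool) :
    weight a b v (fun x => !g x) = weight a b v (fun _ => true) - weight a b v g := by
  rw [eq_comm, Nat.sub_eq_iff_eq_add', weight, weight, weight, ← Finset.sum_add_distrib]
  · exact Finset.sum_congr rfl fun x _ => by cases g x <;> simp
  · exact Finset.sum_le_sum fun x _ => by cases g x <;> simp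

theorem weight_le (g : Point D → Bool) : weight a b v g ≤ weight a b v (fun _ => true) :=
  Finset.sum_le_sum fun x _ => by cases g x <;> simp

theorem weight_or (g h : Point D → Bool) (hgh : ∀ x, ¬ (g x = true ∧ h x = true)) :
    weight a b v (fun x => g x || h x) = weight a b v g + weight a b v h := by
  rw [weight, weight, weight, ← Finset.sum_add_distrib]
  refine Finset.sum_congr rfl fun x _ => ?_
  have := hgh x
  cases hg : g x <;> cases hh : h x <;> simp_all

theorem weight_var (j : Fin m) (y : Fin (D j)) (hab : 0 < a j + b j) :
    weight a b v (fun x => decide (x j = y)) = (a j + if y = v j then b j * D j else 0) *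
      (weight a b v (fun _ => true) / (D j * (a j + b j))) := by
  have hD : 0 < D j * (a j + b j) := Nat.mul_pos (v j).pos hab
  -- The test on x_j is absorbed into the factor of feature j, so that the sum over all points still
  -- factors over the features.
  obtain ⟨u, huj, hu⟩ : ∃ u : (k : Fin m) → Fin (D k) → ℕ,
      (u j = fun z => if z = y then a j + (if y = v j then b j * D j else 0) else 0) ∧
      ∀ k ≠ j, u k = fun z => a k + if z = v k then b k * D k else 0 :=
    ⟨Function.update (fun k z => a k + if z = v k then b k * D k else 0) j _,
      Function.update_self .., fun k hk => Function.update_of_ne hk ..⟩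
  have h1 : ∀ x : Point D, (if decide (x j = y) = true then pointWeight a b v x else 0) =
      ∏ k, u k (x k) := by
    intro x
    rw [← Finset.mul_prod_erase _ _ (Finset.mem_univ j), pointWeight,
      ← Finset.mul_prod_erase _ _ (Finset.mem_univ j), huj]
    by_cases h : x j = y
    · simp only [h, decide_true, if_true]
      congr 1
      exact Finset.prod_congr rfl fun k hk => by rw [hu k (Finset.ne_of_mem_erase hk)]
    · simp [h]
  rw [weight_true, ← Finset.mul_prod_erase _ _ (Finset.mem_univ j), Nat.mul_div_cancel_left _ hD,
    weight, Finset.sum_congr rfl fun x _ => h1 x, sum_prod_eq_prod_sum,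
    ← Finset.mul_prod_erase _ _ (Finset.mem_univ j)]
  congr 1
  · simp [huj]
  · refine Finset.prod_congr rfl fun k hk => ?_
    rw [hu k (Finset.ne_of_mem_erase hk)]
    exact sum_value_weights a b v k

/-- `g` depends only on the features in `A`. -/
def DependsOnly (g : Point D → Bool) (A : Set (Fin m)) : Prop :=
  ∀ x y : Point D, (∀ j ∈ A, x j = y j) → g x = g y

open Classical in
/-- Exchange the values of the features in `B` between two points. -/
noncomputable def swapOn (B : Set (Fin m)) (p : Point D × Point D) : Point D × Point D :=
  (fun j => if j ∈ B then p.2 j else p.1 j, fun j => if j ∈ B then p.1 j else p.2 j)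

theorem swapOn_involutive (B : Set (Fin m)) : Function.Involutive (swapOn (D := D) B) := by
  rintro ⟨x, y⟩
  refine Prod.ext (funext fun j => ?_) (funext fun j => ?_) <;> simp only [swapOn] <;>
    split_ifs <;> rfl

/-- Independence by a bijection: exchanging the values in B between two points x and y preserves the
product of their weights. After the exchange the first point has the value of `g` at x and the value
of `h` at y. -/
theorem weight_and_mul (g h : Point D → Bool) (A B : Set (Fin m)) (hg : DependsOnly g A)
    (hh : DependsOnly h B) (hAB : Disjoint A B) :
    weight a b v (fun x => g x && h x) * weight a b v (fun _ => true) =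
      weight a b v g * weight a b v h := by
  simp only [weight, if_true, Finset.sum_mul_sum]
  rw [← Finset.sum_product', ← Finset.sum_product', Finset.univ_product_univ,
    ← Equiv.sum_comp (swapOn_involutive B).toPerm]
  refine Finset.sum_congr rfl fun p _ => ?_
  have h1 : g ((swapOn B p).1) = g p.1 := hg _ _ fun j hj => by
    simp [swapOn, Set.disjoint_left.1 hAB hj]
  have h2 : h ((swapOn B p).1) = h p.2 := hh _ _ fun j hj => by simp [swapOn, hj]
  have h3 : pointWeight a b v (swapOn B p).1 * pointWeight a b v (swapOn B p).2 =
      pointWeight a b v p.1 * pointWeight a b v p.2 := by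
    simp only [pointWeight, ← Finset.prod_mul_distrib]
    refine Finset.prod_congr rfl fun j _ => ?_
    by_cases hj : j ∈ B <;> simp [swapOn, hj, mul_comm]
  simp only [Function.Involutive.coe_toPerm, h1, h2]
  cases g p.1 <;> cases h p.2 <;> simp [h3]

/-- The hypothesis `hab` makes the total weight positive, so the division is exact. -/
theorem weight_and (hab : ∀ j, 0 < a j + b j) (g h : Point D → Bool) (A B : Set (Fin m))
    (hg : DependsOnly g A) (hh : DependsOnly h B) (hAB : Disjoint A B) :
    weight a b v g * weight a b v h / weight a b v (fun _ => true) =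
      weight a b v (fun x => g x && h x) := by
  rw [← weight_and_mul a b v g h A B hg hh hAB]
  refine Nat.mul_div_cancel _ ?_
  rw [weight_true]
  exact Finset.prod_pos fun j _ => Nat.mul_pos (v j).pos (hab j)

/-- The accumulated conjunction `h` depends only on B, which absorbs A k at each step. Pairwise
disjointness of the inputs keeps B disjoint from all later inputs. -/
theorem foldl_weight_and {ι : Type} (hab : ∀ j, 0 < a j + b j) (g : ι → Point D → Bool)
    (A : ι → Set (Fin m)) (hg : ∀ k, DependsOnly (g k) (A k)) (l : List ι)
    (hl : l.Pairwise fun k k' => Disjoint (A k) (A k')) (h : Point D → Bool) (B : Set (Fin m))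
    (hh : DependsOnly h B) (hB : ∀ k ∈ l, Disjoint B (A k)) :
    l.foldl (fun s k => min (weight a b v fun _ => true)
      (s * weight a b v (g k) / weight a b v fun _ => true)) (weight a b v h) =
      weight a b v (fun x => h x && l.all fun k => g k x) := by
  induction l generalizing h B with
  | nil => simp
  | cons k l ih =>
    rw [List.foldl_cons, weight_and a b v hab h (g k) B (A k) hh (hg k) (hB k (by simp)),
      min_eq_right (weight_le a b v _), ih (List.pairwise_cons.1 hl).2 _ (B ∪ A k)]
    · simp [Bool.and_assoc]
    · intro x y hxy
      beta_reduce
      rw [hh x y fun j hj => hxy j (Or.inl hj), hg k x y fun j hj => hxy j (Or.inr hj)]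
    · exact fun k' hk' => Set.disjoint_union_left.2
        ⟨hB k' (by simp [hk']), (List.pairwise_cons.1 hl).1 k' hk'⟩

theorem foldl_weight_or {ι : Type} (g : ι → Point D → Bool) (l : List ι)
    (hl : l.Pairwise fun k k' => ∀ x, ¬ (g k x = true ∧ g k' x = true)) (h : Point D → Bool)
    (hh : ∀ k ∈ l, ∀ x, ¬ (h x = true ∧ g k x = true)) :
    l.foldl (fun s k => min (weight a b v fun _ => true) (s + weight a b v (g k)))
      (weight a b v h) = weight a b v (fun x => h x || l.any fun k => g k x) := by
  induction l generalizing h with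
  | nil => simp
  | cons k l ih =>
    rw [List.foldl_cons, ← weight_or a b v h (g k) (hh k (by simp)),
      min_eq_right (weight_le a b v _), ih (List.pairwise_cons.1 hl).2]
    · simp [Bool.or_assoc]
    · intro k' hk' x hx
      have h1 := hh k' (by simp [hk']) x
      have h2 := (List.pairwise_cons.1 hl).1 k' hk' x
      cases hhx : h x <;> simp_all

/-- Turns decomposability, a condition on labels, into the semantic independence used for AND gates.
-/
theorem Circuit.dependsOnly_eval (C : Circuit D) (k : Fin (C.n + 1)) :
    DependsOnly (fun x => C.eval x k) (C.vars k) := by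
  obtain ⟨k, hk⟩ := k
  induction k using Nat.strong_induction_on with
  | _ k ih =>
    intro x y hxy
    beta_reduce
    rw [Circuit.vars] at hxy
    rw [Circuit.eval, Circuit.eval]
    cases hG : C.gate ⟨k, hk⟩ with
    | const c => rfl
    | var j c => rw [hG] at hxy; simp only at hxy ⊢; rw [hxy j rfl]
    | not g =>
      rw [hG] at hxy
      simp only at hxy ⊢
      exact congrArg _ (ih g g.2 _ x y hxy)
    | and gs =>
      rw [hG] at hxy
      simp only at hxy ⊢
      rw [Bool.eq_iff_iff, List.all_eq_true, List.all_eq_true]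
      refine forall₂_congr fun g hg => ?_
      exact Bool.eq_iff_iff.1 (ih g g.2 _ x y fun j hj => hxy j ⟨g, hg, hj⟩)
    | or gs =>
      rw [hG] at hxy
      simp only at hxy ⊢
      rw [Bool.eq_iff_iff, List.any_eq_true, List.any_eq_true]
      refine exists_congr fun g => and_congr_right fun hg => ?_
      exact Bool.eq_iff_iff.1 (ih g g.2 _ x y fun j hj => hxy j ⟨g, hg, hj⟩)

end

/-! ### Correctness of the algorithm -/

theorem getD_ofFn {m : ℕ} (f : Fin m → ℕ) (j : Fin m) : (List.ofFn f).getD j 0 = f j := by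
  simp [List.getD_eq_getElem?_getD]

theorem prod_range_getD_ofFn {m : ℕ} (f : Fin m → ℕ) (h : ℕ → ℕ) :
    ∏ j ∈ Finset.range (List.ofFn f).length, h ((List.ofFn f).getD j 0) = ∏ j, h (f j) := by
  rw [List.length_ofFn, Finset.prod_range]
  exact Finset.prod_congr rfl fun j _ => by rw [getD_ofFn]

theorem beq_val {m : ℕ} (i j : Fin m) : Nat.beq i j = decide (i = j) := by
  rw [Bool.eq_iff_iff, Nat.beq_eq, decide_eq_true_iff, Fin.val_inj]

namespace Instance

/-- The domain sizes and the point of an instance as lists. -/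
def lists (I : Instance) : List ℕ × List ℕ := (List.ofFn I.D, List.ofFn fun j => (I.v j : ℕ))

/-- The parameters for the given weights. -/
def params (I : Instance) (w : (ℕ × ℕ) × (ℕ × ℕ)) : Params := (I.lists, ((I.i : ℕ), w))

variable (I : Instance) (w : (ℕ × ℕ) × (ℕ × ℕ))

theorem coefA_params (j : Fin I.m) :
    coefA (I.params w) j = if j = I.i then w.2.1 else w.1.1 := by
  rw [coefA, params, beq_val, Bool.cond_decide]

theorem coefB_params (j : Fin I.m) :
    coefB (I.params w) j = if j = I.i then w.2.2 else w.1.2 := by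
  rw [coefB, params, beq_val, Bool.cond_decide]

/-- The weight of a set of points. -/
def wt (g : Point I.D → Bool) : ℕ :=
  weight (fun j => coefA (I.params w) j) (fun j => coefB (I.params w) j) I.v g

theorem featureWeight_params (j : Fin I.m) :
    featureWeight (I.params w) j = I.D j * (coefA (I.params w) j + coefB (I.params w) j) := by
  rw [featureWeight]
  congr 1
  exact getD_ofFn _ _

theorem totalWeight_params : totalWeight (I.params w) = I.wt w fun _ => true := by
  rw [totalWeight, wt, weight_true]
  change ∏ j ∈ Finset.range (List.ofFn I.D).length, _ = _
  rw [List.length_ofFn, Finset.prod_range]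
  exact Finset.prod_congr rfl fun j _ => I.featureWeight_params w j

theorem valueWeight_params (j : Fin I.m) (y : Fin (I.D j)) :
    valueWeight (I.params w) j y = coefA (I.params w) j +
      if y = I.v j then coefB (I.params w) j * I.D j else 0 := by
  have h1 : (I.params w).1.2.getD j 0 = I.v j := getD_ofFn (fun j => (I.v j : ℕ)) j
  have h2 : (I.params w).1.1.getD j 0 = I.D j := getD_ofFn _ _
  rw [valueWeight, h1, h2]
  congr 1
  rw [beq_val, Bool.cond_decide]

variable {w}

theorem gateWeight_toNats (hw : 0 < w.1.1 + w.1.2) (hw' : 0 < w.2.1 + w.2.2)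
    (k : Fin (I.C.n + 1)) (rest vals : List ℕ)
    (hvals : ∀ g : Fin k, vals.getD g 0 = I.wt w fun x => I.C.eval x (I.C.src k g)) :
    gateWeight (I.params w, totalWeight (I.params w)) ((I.C.gate k).toNats ++ rest, vals) =
      I.wt w fun x => I.C.eval x k := by
  have hab : ∀ j : Fin I.m, 0 < coefA (I.params w) j + coefB (I.params w) j := by
    intro j
    rw [coefA_params, coefB_params]
    split_ifs <;> assumption
  have heval : ∀ x, I.C.eval x k = match I.C.gate k with
      | .const b => b
      | .var j a => decide (x j = a)
      | .not g => !(I.C.eval x (I.C.src k g))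
      | .and gs => gs.all fun g => I.C.eval x (I.C.src k g)
      | .or gs => gs.any fun g => I.C.eval x (I.C.src k g) := by
    intro x
    rw [Circuit.eval]
    cases I.C.gate k <;> rfl
  simp only [heval]
  rw [totalWeight_params]
  cases hG : I.C.gate k with
  | const b =>
    cases b
    · exact (weight_false _ _ _).symm
    · rfl
  | var j y =>
    simp only [wt]
    rw [weight_var _ _ _ _ _ (hab j), ← I.valueWeight_params w j y, ← I.featureWeight_params w j]
    rfl
  | not g =>
    simp only [wt]
    rw [weight_not]
    exact congrArg _ (hvals g)
  | and gs =>
    have h := foldl_weight_and (fun j => coefA (I.params w) j) (fun j => coefB (I.params w) j) I.v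
      hab (fun g x => I.C.eval x (I.C.src k g)) (fun g => I.C.vars (I.C.src k g))
      (fun g => I.C.dependsOnly_eval _) gs (I.decomposable k gs hG) (fun _ => true) ∅
      (fun _ _ _ => rfl) (fun _ _ => Set.empty_disjoint _)
    -- The fold starts with the constant `true`, whose weight is the total weight and which depends
    -- on no feature.
    simp only [Bool.true_and] at h
    refine Eq.trans ?_ h
    change ((gs.map Fin.val ++ rest).take gs.length).foldl _ _ = _
    rw [List.take_left' (by simp), List.foldl_map]
    simp only [hvals]
    rfl
  | or gs =>
    have h := foldl_weight_or (fun j => coefA (I.params w) j) (fun j => coefB (I.params w) j) I.v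
      (fun g x => I.C.eval x (I.C.src k g)) gs (I.deterministic k gs hG) (fun _ => false)
      (fun _ _ _ => by simp)
    simp only [Bool.false_or] at h
    refine Eq.trans ?_ h
    change ((gs.map Fin.val ++ rest).take gs.length).foldl _ _ = _
    rw [List.take_left' (by simp), List.foldl_map, weight_false]
    simp only [hvals]
    rfl

theorem dropGate_toNats {m : ℕ} {D : Fin m → ℕ} {k : ℕ} (G : Gate D k) (rest : List ℕ) :
    dropGate (G.toNats ++ rest) = rest := by
  cases G with
  | const b => rfl
  | var j y => rfl
  | not g => rfl
  | and gs => exact List.drop_left' (by simp [Gate.toNats])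
  | or gs => exact List.drop_left' (by simp [Gate.toNats])

theorem toNats_ne_nil {m : ℕ} {D : Fin m → ℕ} {k : ℕ} (G : Gate D k) : G.toNats ≠ [] := by
  cases G <;> simp [Gate.toNats]

/-- The encoded gates. -/
def gates : List (List ℕ) := List.ofFn fun k => (I.C.gate k).toNats

/-- The weight of the set of points where gate `k` is true. -/
noncomputable def gateWt (w : (ℕ × ℕ) × (ℕ × ℕ)) (k : ℕ) : ℕ :=
  if h : k < I.C.n + 1 then I.wt w fun x => I.C.eval x ⟨k, h⟩ else 0

/-- The invariant of the main loop: after k steps the first k gates are consumed and their weights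
listed. Inputs of gate k precede it, so their weights are available; the clamping is harmless by
`weight_le`. -/
theorem iterate_gateStep (hw : 0 < w.1.1 + w.1.2) (hw' : 0 < w.2.1 + w.2.2) (k : ℕ)
    (hk : k ≤ I.C.n + 1) :
    (gateStep (I.params w, totalWeight (I.params w)))^[k] (I.gates.flatten, []) =
      ((I.gates.drop k).flatten, (List.range k).map (I.gateWt w)) := by
  induction k with
  | zero => rfl
  | succ k ih =>
    have hk' : k < I.C.n + 1 := hk
    have hlen : k < I.gates.length := by simpa [gates] using hk'
    rw [Function.iterate_succ_apply', ih hk'.le, List.drop_eq_getElem_cons hlen, List.flatten_cons]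
    have hg : I.gates[k] = (I.C.gate ⟨k, hk'⟩).toNats := List.getElem_ofFn _
    have hne : ((I.C.gate ⟨k, hk'⟩).toNats ++ (I.gates.drop (k + 1)).flatten).isEmpty = false := by
      simp [toNats_ne_nil]
    rw [hg, gateStep, hne, cond_false, dropGate_toNats, I.gateWeight_toNats hw hw' ⟨k, hk'⟩,
      List.range_succ, List.map_append]
    · refine Prod.ext rfl ?_
      change _ ++ [_] = _ ++ [_]
      rw [totalWeight_params, gateWt, dif_pos hk']
      exact congrArg (fun n => _ ++ [n]) (min_eq_right (weight_le _ _ _ _))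
    · intro g
      have hgk : (g : ℕ) < k := g.2
      have : (g : ℕ) < I.C.n + 1 := by omega
      rw [List.getD_eq_getElem?_getD, List.getElem?_map, List.getElem?_range hgk]
      simp [gateWt, this]

theorem gateWeights_getD (hw : 0 < w.1.1 + w.1.2) (hw' : 0 < w.2.1 + w.2.2) :
    (gateWeights (I.params w) I.gates.flatten).getD I.C.n 0 = I.wt w I.C.classify := by
  -- Every gate is encoded by at least one number, so the clock does not stop too early.
  have hlen : I.C.n + 1 ≤ I.gates.flatten.length := by
    have h : ∀ L : List (List ℕ), (∀ l ∈ L, l ≠ []) → L.length ≤ L.flatten.length := by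
      intro L
      induction L with
      | nil => simp
      | cons l L ih =>
        intro h
        have h1 := ih fun l hl => h l (by simp [hl])
        have h2 := List.length_pos_iff.2 (h l (by simp))
        simp only [List.flatten_cons, List.length_append, List.length_cons]
        omega
    refine le_trans (by simp [gates]) (h I.gates fun l hl => ?_)
    obtain ⟨k, rfl⟩ := (List.mem_ofFn' _ _).1 hl
    exact toNats_ne_nil _
  have hfix : ∀ t vals, (gateStep (I.params w, totalWeight (I.params w)))^[t] ([], vals) =
      ([], vals) := fun t vals => Function.iterate_fixed rfl t
  have hdrop : I.gates.drop (I.C.n + 1) = [] := List.drop_of_length_le (by simp [gates])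
  obtain ⟨t, ht⟩ := Nat.exists_eq_add_of_le' hlen
  rw [gateWeights, List.foldl_const, ht, Function.iterate_add_apply,
    I.iterate_gateStep hw hw' _ le_rfl, hdrop, List.flatten_nil, hfix, List.getD_eq_getElem?_getD,
    List.getElem?_map, List.getElem?_range (Nat.lt_succ_self _)]
  simp only [Option.map_some, Option.getD_some, gateWt, Nat.lt_succ_self, dif_pos]
  rfl

/-- The parsed instance. -/
def parsed : (List ℕ × List ℕ) × (ℕ × (ℕ × List ℕ)) :=
  (I.lists, ((I.i : ℕ), (I.C.n, I.gates.flatten)))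

/-- The similarity predicate. -/
def sim (x : Point I.D) : Bool := I.C.classify x == I.C.classify I.v

theorem simWeight_parsed (hw : 0 < w.1.1 + w.1.2) (hw' : 0 < w.2.1 + w.2.2) :
    simWeight I.parsed w = I.wt w I.sim := by
  have h1 : (gateWeights (I.params w) I.gates.flatten).getD I.C.n 0 = I.wt w I.C.classify :=
    I.gateWeights_getD hw hw'
  have h2 : (gateWeights (I.params ((0, 1), (0, 1))) I.gates.flatten).getD I.C.n 0 =
      I.wt ((0, 1), (0, 1)) I.C.classify :=
    I.gateWeights_getD (by norm_num) (by norm_num)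
  -- With these weights v is the only point of nonzero weight, and its weight is ∏ D_j > 0.
  have h3 : I.wt ((0, 1), (0, 1)) I.C.classify =
      if I.C.classify I.v = true then ∏ j, I.D j else 0 := by
    have h : ∀ x, pointWeight (fun j => coefA (I.params ((0, 1), (0, 1))) j)
        (fun j => coefB (I.params ((0, 1), (0, 1))) j) I.v x =
        if x = I.v then ∏ j, I.D j else 0 := by
      intro x
      simp only [pointWeight, coefA_params, coefB_params, ite_self, zero_add, one_mul,
        Finset.prod_ite_zero, Finset.mem_univ, forall_true_left, funext_iff]
    simp only [wt, weight, h]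
    rw [Finset.sum_eq_single I.v (fun x _ hx => by simp [hx]) (fun h => absurd (Finset.mem_univ _) h)]
    simp
  have hpos : ∏ j, I.D j ≠ 0 := (Finset.prod_pos fun j _ => (I.v j).pos).ne'
  change (bif (gateWeights (I.params ((0, 1), (0, 1))) I.gates.flatten).getD I.C.n 0 == 0 then
    totalWeight (I.params w) - (gateWeights (I.params w) I.gates.flatten).getD I.C.n 0
    else (gateWeights (I.params w) I.gates.flatten).getD I.C.n 0) = _
  rw [h1, h2, h3, totalWeight_params]
  cases hv : I.C.classify I.v
  · have : I.sim = fun x => !I.C.classify x := by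
      funext x
      rw [sim, hv]
      cases I.C.classify x <;> rfl
    rw [this, wt, wt, wt, weight_not]
    simp
  · have : I.sim = I.C.classify := by
      funext x
      rw [sim, hv]
      cases I.C.classify x <;> rfl
    rw [this, if_pos rfl, beq_false_of_ne hpos, cond_false]

/-- The numbers that encode an instance. -/
def toNats : List ℕ :=
  [I.m] ++ List.ofFn I.D ++ List.ofFn (fun j => (I.v j : ℕ)) ++ [(I.i : ℕ)] ++ [I.C.n] ++
    I.gates.flatten

theorem parse_toNats : parse I.toNats = I.parsed := by
  have h : I.toNats = I.m :: (List.ofFn I.D ++ (List.ofFn (fun j => (I.v j : ℕ)) ++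
      ((I.i : ℕ) :: I.C.n :: I.gates.flatten))) := by simp [toNats]
  have h1 : (List.ofFn I.D).length = I.m := List.length_ofFn
  have h2 : (List.ofFn fun j => (I.v j : ℕ)).length = I.m := List.length_ofFn
  rw [h, parse, List.headD_cons, List.tail_cons, List.take_left' h1, List.drop_left' h1,
    List.take_left' h2, List.drop_left' h2]
  rfl

/-- The computed fraction. -/
def fraction : ℤ × ℕ :=
  (((numerators I.parsed).1 : ℤ) - (numerators I.parsed).2, denominator (List.ofFn I.D))

theorem scoreWord_encode : scoreWord I.encode = encodeFraction I.fraction := by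
  have h : I.encode = encodeNats I.toNats := rfl
  rw [scoreWord, h, decodeNats_encodeNats, parse_toNats]
  rw [encodeFraction, scoreNats, fraction]
  refine congrArg encodeNats ?_
  simp only [List.cons.injEq, and_true]
  refine ⟨?_, by omega, rfl⟩
  by_cases hle : (numerators I.parsed).2 ≤ (numerators I.parsed).1
  · rw [Nat.ble_eq_true_of_le hle, cond_true, if_neg (by omega)]
  · rw [Bool.eq_false_of_not_eq_true (fun h => hle (Nat.le_of_ble_eq_true h)), cond_false,
      if_pos (by omega)]

theorem denominator_ofFn : denominator (List.ofFn I.D) = I.m.factorial * ∏ j, I.D j := by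
  rw [denominator, prod_range_getD_ofFn I.D fun n => n, List.length_ofFn]

theorem fraction_snd_ne_zero : I.fraction.2 ≠ 0 := by
  change denominator _ ≠ 0
  rw [denominator_ofFn]
  exact Nat.mul_ne_zero (Nat.factorial_ne_zero _) (Finset.prod_pos fun j _ => (I.v j).pos).ne'

theorem digitBase_ofFn : digitBase (List.ofFn I.D) = ∏ j, (2 * I.D j) + 1 := by
  rw [digitBase, prod_range_getD_ofFn I.D fun n => 2 * n]

/-- Both numerators are sums of digits with Shapley coefficients, for base `digitBase` and the two
choices of weights for feature i. Their difference over m! ∏ D_j is the score. -/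
theorem score_eq : I.score = (I.fraction.1 : ℝ) / (I.fraction.2 : ℝ) := by
  have h1 : (numerators I.parsed).1 = ∑ S ∈ (Finset.univ \ {I.i}).powerset,
      S.card.factorial * (I.m - S.card - 1).factorial * scaledCount I.sim I.v (S ∪ {I.i}) := by
    change weightedDigits (List.ofFn I.D) (digitBase (List.ofFn I.D)) (simWeight I.parsed
      ((1, digitBase (List.ofFn I.D)), (0, 1))) = _
    rw [simWeight_parsed _ (by change 0 < 1 + _; omega) (by norm_num), wt]
    simp only [coefA_params, coefB_params]
    rw [weight_pos_part, weightedDigits_eq _ _ _ (fun S => S ∪ {I.i}) _ List.length_ofFn _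
      I.digitBase_ofFn]
  have h2 : (numerators I.parsed).2 = ∑ S ∈ (Finset.univ \ {I.i}).powerset,
      S.card.factorial * (I.m - S.card - 1).factorial * scaledCount I.sim I.v S := by
    change weightedDigits (List.ofFn I.D) (digitBase (List.ofFn I.D)) (simWeight I.parsed
      ((1, digitBase (List.ofFn I.D)), (1, 0))) = _
    rw [simWeight_parsed _ (by change 0 < 1 + _; omega) (by norm_num), wt]
    simp only [coefA_params, coefB_params, ite_self]
    rw [weight_neg_part, weightedDigits_eq _ _ _ (fun S => S) _ List.length_ofFn _
      I.digitBase_ofFn]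
  rw [score, shapley_simCharFun, fraction, denominator_ofFn, h1, h2]
  push_cast
  rfl

end Instance

end SimShap

theorem mainTheorem6 :
    ∃ f : SimShap.Instance → ℤ × ℕ,
      (∀ I : SimShap.Instance,
        (f I).2 ≠ 0 ∧ I.score = ((f I).1 : ℝ) / ((f I).2 : ℝ)) ∧
      Nonempty (Turing.TM2ComputableInPolyTime
        SimShap.Instance.encode SimShap.encodeFraction f) :=
  ⟨SimShap.Instance.fraction, fun I => ⟨I.fraction_snd_ne_zero, I.score_eq⟩,
    SimShap.PT.scoreWord.turing fun I => I.scoreWord_encode⟩
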